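/- Theorem. Let $W$ be a countable transitive model of ZFC and let $n\ge 1$ be a natural number. Then there are pairwise distinct reals $c_0,\ldots,c_n\in 2^\omega$ such that 1. each $c_i$ is a $W$-generic Cohen real, that is, the set $G_{c_i}$ of finite initial segments of $c_i$ is a $W$-generic filter for Cohen forcing $2^{<\omega}$ (finite binary sequences, longer sequences being stronger conditions); 2. any proper subset of $\{c_0,\ldots,c_n\}$ is mutually $W$-generic, that is, for every proper subset $s\subsetneq\{0,\ldots,n\}$ the product filter $\prod_{i\in s}G_{c_i}$ is $W$-generic for the product forcing $\prod_{i\in s}2^{<\omega}$; 3. the forcing extensions $W[c_0],\ldots,W[c_n]$ have no common extension to a model of set theory with the same ordinals as $W$: there is no transitive model $U$ of ZFC with $U\cap\mathrm{Ord}=W\cap\mathrm{Ord}$ and $W[c_i]\subseteq U$ for all $i\le n$. Here a filter $G$ on a forcing notion $\mathbb P\in W$ is $W$-generic if it meets every dense set $D\subseteq\mathbb P$ with $D\in W$, and $W[c_i]=W[G_{c_i}]$ is the set of the values by $G_{c_i}$ of all $2^{<\omega}$-names in $W$. -/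

import Mathlib

universe u

namespace CohenAmalgamation

/-! ### The language of set theory and the axioms of ZFC -/

/-- The only symbol of the language of set theory: a binary relation symbol. -/
inductive MemRel : ℕ → Type
  | mem : MemRel 2

/-- The first-order language of set theory. -/
def setLang : FirstOrder.Language := ⟨fun _ => Empty, MemRel⟩

/-- The interpretation of the membership symbol in a structure. -/
def E {M : Type*} [setLang.Structure M] (x y : M) : Prop :=
  FirstOrder.Language.Structure.RelMap (L := setLang) MemRel.mem ![x, y]

/-- `M` satisfies ZFC. Separation and replacement are schemes: they range over all
first-order formulas of the language of set theory, with parameters from `M`. -/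
structure SatisfiesZFC (M : Type*) [setLang.Structure M] : Prop where
  extensionality : ∀ x y : M, (∀ z, E z x ↔ E z y) → x = y
  foundation : ∀ x : M, (∃ y, E y x) → ∃ y, E y x ∧ ∀ z, E z x → ¬ E z y
  pairing : ∀ x y : M, ∃ z, ∀ w, E w z ↔ w = x ∨ w = y
  union : ∀ x : M, ∃ v, ∀ w, E w v ↔ ∃ y, E y x ∧ E w y
  powerset : ∀ x : M, ∃ v, ∀ y, E y v ↔ ∀ z, E z y → E z x
  infinity : ∃ x : M, (∃ e, E e x ∧ ∀ z, ¬ E z e) ∧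
    ∀ y, E y x → ∃ y', E y' x ∧ ∀ z, E z y' ↔ E z y ∨ z = y
  separation : ∀ (k : ℕ) (φ : setLang.Formula (Fin (k + 1))) (p : Fin k → M) (a : M),
    ∃ b, ∀ x, E x b ↔ E x a ∧ φ.Realize (Matrix.vecCons x p)
  replacement : ∀ (k : ℕ) (φ : setLang.Formula (Fin (k + 2))) (p : Fin k → M) (a : M),
    (∀ x, E x a → ∃! y, φ.Realize (Matrix.vecCons x (Matrix.vecCons y p))) →
      ∃ b, ∀ y, E y b ↔ ∃ x, E x a ∧ φ.Realize (Matrix.vecCons x (Matrix.vecCons y p))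
  choice : ∀ x : M, (∀ y, E y x → ∃ z, E z y) →
    (∀ y y' z, E y x → E y' x → E z y → E z y' → y = y') →
      ∃ c, ∀ y, E y x → ∃! z, E z y ∧ E z c

/-- A collection of sets, as a structure for the language of set theory with the true membership
relation. -/
instance memStructure (W : Set ZFSet.{u}) : setLang.Structure W where
  funMap := fun f _ => nomatch f
  RelMap := fun r => match r with
    | MemRel.mem => fun v => (v 0 : ZFSet.{u}) ∈ (v 1 : ZFSet.{u})

theorem E_iff {W : Set ZFSet.{u}} (x y : W) : E x y ↔ (x : ZFSet.{u}) ∈ (y : ZFSet.{u}) :=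
  Iff.rfl

/-- `W` is a transitive model of ZFC. -/
structure IsTransitiveModel (W : Set ZFSet.{u}) : Prop where
  transitive : ∀ x ∈ W, ∀ y ∈ x, y ∈ W
  zfc : SatisfiesZFC W

/-- `W` and `U` have the same ordinals. -/
def SameOrdinals (W U : Set ZFSet.{u}) : Prop :=
  ∀ x : ZFSet.{u}, x.IsOrdinal → (x ∈ W ↔ x ∈ U)

/-! ### Generic filters and forcing extensions

A forcing notion is given by its set `P` of conditions and its order `R`, a set of ordered pairs;
`pair p q ∈ R` means that `p` is stronger than or equal to `q`. -/

/-- `D` is a dense subset of the forcing notion `(P, R)`. -/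
def IsDenseIn (P R D : ZFSet.{u}) : Prop :=
  D ⊆ P ∧ ∀ p ∈ P, ∃ d ∈ D, ZFSet.pair d p ∈ R

/-- `G` is a `W`-generic filter on the forcing notion `(P, R)`. -/
structure IsGenericFilter (W : Set ZFSet.{u}) (P R G : ZFSet.{u}) : Prop where
  subset : G ⊆ P
  nonempty : ∃ p, p ∈ G
  upward : ∀ p ∈ G, ∀ q ∈ P, ZFSet.pair p q ∈ R → q ∈ G
  directed : ∀ p ∈ G, ∀ q ∈ G, ∃ r ∈ G, ZFSet.pair r p ∈ R ∧ ZFSet.pair r q ∈ R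
  generic : ∀ D ∈ W, IsDenseIn P R D → ∃ p ∈ G, p ∈ D

/-- `τ` is a `P`-name: a set of pairs `(σ, p)` where `p ∈ P` and `σ` is itself a `P`-name. -/
inductive IsName (P : ZFSet.{u}) : ZFSet.{u} → Prop
  | mk (τ : ZFSet.{u}) (isPair : ∀ z ∈ τ, ∃ σ p, p ∈ P ∧ z = ZFSet.pair σ p)
      (isName : ∀ σ p, ZFSet.pair σ p ∈ τ → IsName P σ) : IsName P τ

theorem rank_lt_of_pair_mem {σ p τ : ZFSet.{u}} (h : ZFSet.pair σ p ∈ τ) :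
    σ.rank < τ.rank := by
  have h1 : σ ∈ ({σ} : ZFSet.{u}) := by simp
  have h2 : ({σ} : ZFSet.{u}) ∈ ZFSet.pair σ p := by simp [ZFSet.pair]
  exact (ZFSet.rank_lt_of_mem h1).trans
    ((ZFSet.rank_lt_of_mem h2).trans (ZFSet.rank_lt_of_mem h))

/-- The set of those `σ` for which `(σ, p) ∈ τ` for some `p ∈ G`. -/
noncomputable def activeNames (G τ : ZFSet.{u}) : ZFSet.{u} :=
  (ZFSet.sUnion (ZFSet.sUnion τ)).sep fun σ => ∃ p ∈ G, ZFSet.pair σ p ∈ τ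

theorem mem_activeNames {G τ σ : ZFSet.{u}} :
    σ ∈ activeNames G τ ↔ ∃ p ∈ G, ZFSet.pair σ p ∈ τ := by
  rw [activeNames, ZFSet.mem_sep]
  refine ⟨fun h => h.2, fun h => ⟨?_, h⟩⟩
  obtain ⟨p, -, hp⟩ := h
  rw [ZFSet.mem_sUnion]
  refine ⟨{σ}, ?_, by simp⟩
  rw [ZFSet.mem_sUnion]
  exact ⟨_, hp, by simp [ZFSet.pair]⟩

/-- The value of the name `τ` by the filter `G`; see `mem_val` for the defining equation
`val G τ = {val G σ | (σ, p) ∈ τ for some p ∈ G}`. -/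
noncomputable def val (G τ : ZFSet.{u}) : ZFSet.{u} :=
  ZFSet.range fun σ : {σ : ZFSet.{u} // σ ∈ activeNames G τ} => val G σ.1
termination_by τ.rank
decreasing_by
  obtain ⟨p, -, hp⟩ := mem_activeNames.1 σ.2
  exact rank_lt_of_pair_mem hp

theorem mem_val {G τ x : ZFSet.{u}} :
    x ∈ val G τ ↔ ∃ σ, ∃ p ∈ G, ZFSet.pair σ p ∈ τ ∧ val G σ = x := by
  rw [val, ZFSet.mem_range]
  constructor
  · rintro ⟨⟨σ, hσ⟩, rfl⟩
    obtain ⟨p, hp, h⟩ := mem_activeNames.1 hσ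
    exact ⟨σ, p, hp, h, rfl⟩
  · rintro ⟨σ, p, hp, h, rfl⟩
    exact ⟨⟨σ, mem_activeNames.2 ⟨p, hp, h⟩⟩, rfl⟩

/-- The forcing extension `W[G]`: the values by `G` of all `P`-names in `W`. -/
def forcingExtension (W : Set ZFSet.{u}) (P G : ZFSet.{u}) : Set ZFSet.{u} :=
  {x | ∃ τ ∈ W, IsName P τ ∧ val G τ = x}

/-! ### Cohen forcing -/

/-- The natural number `m` as a von Neumann ordinal. -/
noncomputable def natCode (m : ℕ) : ZFSet.{u} := (m : Ordinal.{u}).toZFSet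

/-- The finite binary sequence `l` as a set: the function `i ↦ l i` from the natural number
`l.length` to `2 = {0, 1}`. -/
noncomputable def seqCode (l : List Bool) : ZFSet.{u} :=
  ZFSet.range fun i : Fin l.length => ZFSet.pair (natCode i) (natCode (l.get i).toNat)

/-- The set `2^{<ω}` of conditions of Cohen forcing. -/
noncomputable def cohenForcing : ZFSet.{u} := ZFSet.range seqCode.{u}

/-- The order of Cohen forcing: longer sequences are stronger. -/
noncomputable def cohenOrder : ZFSet.{u} :=
  ZFSet.range fun a : {a : List Bool × List Bool // a.2 <+: a.1} =>
    ZFSet.pair (seqCode a.1.1) (seqCode a.1.2)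

/-- The initial segment of length `m` of the real `c ∈ 2^ω`. -/
def initialSegment (c : ℕ → Bool) (m : ℕ) : List Bool := List.ofFn fun i : Fin m => c i

/-- The filter on Cohen forcing associated with the real `c`: its finite initial segments. -/
noncomputable def cohenFilter (c : ℕ → Bool) : ZFSet.{u} :=
  ZFSet.range fun m : ℕ => seqCode (initialSegment c m)

/-- `c` is a `W`-generic Cohen real. -/
def IsCohenReal (W : Set ZFSet.{u}) (c : ℕ → Bool) : Prop :=
  IsGenericFilter W cohenForcing cohenOrder (cohenFilter c)

/-- The forcing extension `W[c]` by the Cohen real `c`. -/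
def cohenExtension (W : Set ZFSet.{u}) (c : ℕ → Bool) : Set ZFSet.{u} :=
  forcingExtension W cohenForcing (cohenFilter c)

/-! ### Finite products of Cohen forcing and mutual genericity -/

/-- The tuple `(t i)_{i ∈ s}` of conditions as a set: the function with domain `s` that maps
`i` to `t i`. -/
noncomputable def tupleCode {k : ℕ} {s : Finset (Fin k)} (t : s → List Bool) : ZFSet.{u} :=
  ZFSet.range fun i : s => ZFSet.pair (natCode (i : Fin k)) (seqCode (t i))

/-- The conditions of the product of copies of Cohen forcing indexed by `s`. -/
noncomputable def productForcing {k : ℕ} (s : Finset (Fin k)) : ZFSet.{u} :=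
  ZFSet.range fun t : s → List Bool => tupleCode t

/-- The coordinatewise order of the product forcing. -/
noncomputable def productOrder {k : ℕ} (s : Finset (Fin k)) : ZFSet.{u} :=
  ZFSet.range fun a : {a : (s → List Bool) × (s → List Bool) // ∀ i, a.2 i <+: a.1 i} =>
    ZFSet.pair (tupleCode a.1.1) (tupleCode a.1.2)

/-- The product of the filters associated with the reals `c i`, for `i ∈ s`. -/
noncomputable def productFilter {k : ℕ} (c : Fin k → ℕ → Bool) (s : Finset (Fin k)) :
    ZFSet.{u} :=
  ZFSet.range fun m : s → ℕ => tupleCode fun i : s => initialSegment (c i) (m i)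

/-- The reals `c i`, for `i ∈ s`, are mutually `W`-generic: the product of their filters is
`W`-generic for the product of copies of Cohen forcing. -/
def MutuallyGeneric (W : Set ZFSet.{u}) {k : ℕ} (c : Fin k → ℕ → Bool)
    (s : Finset (Fin k)) : Prop :=
  IsGenericFilter W (productForcing s) (productOrder s) (productFilter c s)

end CohenAmalgamation

/-! The ordinals of `W` form a countable ordinal `θ` that does not belong to `W`. The reals are
built so that any proper subfamily is generic, while all of them together code the membership
relation on `θ`. A common extension `U` would decode this relation, collapse it and so contain `θ`;
having the same ordinals as `W`, it cannot.

Fix enumerations `o` of the ordinals of `W` and `q` of the pairs `(j, k)` with `o j ∈ o k`. Call a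
position marked if all the reals have value one there. Every dense set to be met constrains only a
proper subset of the coordinates, so it can be met by a finite extension during which some other
coordinate is kept at zero: no mark appears by accident. Then a mark is placed on purpose, and the
distances from it to the next one in the coordinates `a` and `b` record the pair `(j, k)`. As `j ≠
k`, these two ones do not produce a further mark. This is `exists_coding_step`; iterating it along
enumerations of the countably many dense sets and of the pairs gives `exists_coding`. The hypothesis
on the dense sets is `IsSparselyDense`, and properness of the index set is what yields it in
`isSparselyDense_tuple`.

On the side of `U`, `realSet_mem_cohenExtension` puts each real into its extension by means of a
name, `dfn_coded` shows that the coded relation is definable from the reals, and `range_mem_of_dfn`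
is the Mostowski collapse inside `U`. All three rest on recursion in a transitive model,
`exists_recursion`. The calculus of `Dfn` and `DTerm` produces the formulas that separation and
replacement require. -/

namespace CohenAmalgamation

open FirstOrder Language

/-! ### Definability in a transitive collection of sets -/

/-- `Q` is definable over `U` by a first-order formula with parameters from `U`. -/
def Dfn (U : Set ZFSet.{u}) {n : ℕ} (Q : (Fin n → U) → Prop) : Prop :=
  ∃ φ : setLang.BoundedFormula U n, ∀ xs, φ.Realize id xs ↔ Q xs

/-- `a` is a function with values in `U` whose graph is definable over `U`. -/
def DTerm (U : Set ZFSet.{u}) {n : ℕ} (a : (Fin n → U) → ZFSet.{u}) : Prop :=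
  (∀ v, a v ∈ U) ∧
    Dfn U fun v : Fin (n + 1) → U => (v (Fin.last n) : ZFSet.{u}) = a (Fin.init v)

/-- The membership symbol as a relation symbol of the language of set theory. -/
def memSymbol : setLang.Relations 2 := MemRel.mem

variable {U : Set ZFSet.{u}} {n : ℕ}

namespace Dfn

theorem congr {Q Q' : (Fin n → U) → Prop} (h : Dfn U Q) (e : ∀ v, Q' v ↔ Q v) : Dfn U Q' := by
  obtain ⟨φ, hφ⟩ := h
  exact ⟨φ, fun v => (hφ v).trans (e v).symm⟩

theorem not {Q : (Fin n → U) → Prop} (h : Dfn U Q) : Dfn U fun v => ¬ Q v := by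
  obtain ⟨φ, hφ⟩ := h
  exact ⟨φ.not, fun v => by rw [BoundedFormula.realize_not, hφ]⟩

theorem and {Q Q' : (Fin n → U) → Prop} (h : Dfn U Q) (h' : Dfn U Q') :
    Dfn U fun v => Q v ∧ Q' v := by
  obtain ⟨φ, hφ⟩ := h
  obtain ⟨ψ, hψ⟩ := h'
  exact ⟨φ ⊓ ψ, fun v => by rw [BoundedFormula.realize_inf, hφ, hψ]⟩

theorem or {Q Q' : (Fin n → U) → Prop} (h : Dfn U Q) (h' : Dfn U Q') :
    Dfn U fun v => Q v ∨ Q' v := by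
  obtain ⟨φ, hφ⟩ := h
  obtain ⟨ψ, hψ⟩ := h'
  exact ⟨φ ⊔ ψ, fun v => by rw [BoundedFormula.realize_sup, hφ, hψ]⟩

theorem imp {Q Q' : (Fin n → U) → Prop} (h : Dfn U Q) (h' : Dfn U Q') :
    Dfn U fun v => Q v → Q' v := by
  obtain ⟨φ, hφ⟩ := h
  obtain ⟨ψ, hψ⟩ := h'
  exact ⟨φ.imp ψ, fun v => by rw [BoundedFormula.realize_imp, hφ, hψ]⟩

theorem iff {Q Q' : (Fin n → U) → Prop} (h : Dfn U Q) (h' : Dfn U Q') :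
    Dfn U fun v => (Q v ↔ Q' v) := by
  obtain ⟨φ, hφ⟩ := h
  obtain ⟨ψ, hψ⟩ := h'
  exact ⟨φ.iff ψ, fun v => by rw [BoundedFormula.realize_iff, hφ, hψ]⟩

theorem forall_finite {β : Type*} [Finite β] {Q : β → (Fin n → U) → Prop}
    (h : ∀ b, Dfn U (Q b)) : Dfn U fun v => ∀ b, Q b v := by
  choose φ hφ using h
  exact ⟨BoundedFormula.iInf φ, fun v => by simp only [BoundedFormula.realize_iInf, hφ]⟩

theorem all {Q : (Fin n → U) → U → Prop}
    (h : Dfn U fun v : Fin (n + 1) → U => Q (Fin.init v) (v (Fin.last n))) :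
    Dfn U fun v => ∀ x : U, Q v x := by
  obtain ⟨φ, hφ⟩ := h
  refine ⟨φ.all, fun v => ?_⟩
  rw [BoundedFormula.realize_all]
  refine forall_congr' fun x => (hφ _).trans ?_
  simp only [Fin.init_snoc, Fin.snoc_last]

theorem ex {Q : (Fin n → U) → U → Prop}
    (h : Dfn U fun v : Fin (n + 1) → U => Q (Fin.init v) (v (Fin.last n))) :
    Dfn U fun v => ∃ x : U, Q v x := by
  obtain ⟨φ, hφ⟩ := h
  refine ⟨φ.ex, fun v => ?_⟩
  rw [BoundedFormula.realize_ex]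
  refine exists_congr fun x => (hφ _).trans ?_
  simp only [Fin.init_snoc, Fin.snoc_last]

/-- The indexed variables are first turned into free ones by `toFormula`, since relabelling acts on
free variables only; parameters stay fixed. -/
theorem rename {m : ℕ} {Q : (Fin n → U) → Prop} (h : Dfn U Q) (σ : Fin n → Fin m) :
    Dfn U fun v : Fin m → U => Q fun i => v (σ i) := by
  obtain ⟨φ, hφ⟩ := h
  let g : U ⊕ Fin n → U ⊕ Fin m := Sum.map id σ
  refine ⟨BoundedFormula.relabel (n := m) (k := 0) g φ.toFormula, fun v => ?_⟩
  refine Iff.trans ?_ (hφ _)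
  refine BoundedFormula.realize_relabel.trans ?_
  have : (v ∘ Fin.natAdd m : Fin 0 → U) = default := Subsingleton.elim _ _
  rw [this]
  refine (BoundedFormula.realize_toFormula φ _).trans ?_
  rfl

theorem mem_var (i j : Fin n) :
    Dfn U fun v : Fin n → U => (v i : ZFSet.{u}) ∈ (v j : ZFSet.{u}) := by
  refine ⟨Relations.boundedFormula₂ memSymbol (Term.var (Sum.inr i))
    (Term.var (Sum.inr j)), fun v => ?_⟩
  exact BoundedFormula.realize_rel₂.trans Iff.rfl

theorem eq_var (i j : Fin n) :
    Dfn U fun v : Fin n → U => (v i : ZFSet.{u}) = (v j : ZFSet.{u}) := by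
  refine ⟨Term.bdEqual (L := setLang) (Term.var (Sum.inr i)) (Term.var (Sum.inr j)), fun v => ?_⟩
  rw [BoundedFormula.realize_bdEqual]
  exact Subtype.ext_iff

theorem eq_const (i : Fin n) (c : U) :
    Dfn U fun v : Fin n → U => (v i : ZFSet.{u}) = (c : ZFSet.{u}) := by
  refine ⟨Term.bdEqual (L := setLang) (Term.var (Sum.inr i)) (Term.var (Sum.inl c)), fun v => ?_⟩
  rw [BoundedFormula.realize_bdEqual]
  exact Subtype.ext_iff

end Dfn

namespace DTerm

theorem var (i : Fin n) : DTerm U fun v : Fin n → U => (v i : ZFSet.{u}) :=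
  ⟨fun v => (v i).2, Dfn.eq_var (Fin.last n) i.castSucc⟩

theorem const {c : ZFSet.{u}} (hc : c ∈ U) : DTerm U fun _ : Fin n → U => c :=
  ⟨fun _ => hc, Dfn.eq_const (Fin.last n) ⟨c, hc⟩⟩

theorem rename {m : ℕ} {a : (Fin n → U) → ZFSet.{u}} (h : DTerm U a) (σ : Fin n → Fin m) :
    DTerm U fun v : Fin m → U => a fun i => v (σ i) := by
  refine ⟨fun v => h.1 _, ?_⟩
  refine (h.2.rename (Fin.lastCases (Fin.last m) fun i => (σ i).castSucc)).congr fun v => ?_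
  simp only [Fin.lastCases_last]
  congr! 2
  funext i
  simp [Fin.init]

theorem init {a : (Fin n → U) → ZFSet.{u}} (h : DTerm U a) :
    DTerm U fun v : Fin (n + 1) → U => a (Fin.init v) :=
  h.rename Fin.castSucc

end DTerm

namespace Dfn

/-- Substitution of definable functions, which are not terms of the language: each argument is
replaced by a new variable `y`, existentially quantified and bound by the formula `y = l v`. The
induction in `key` removes the last argument first and carries the original `n` variables along. -/
theorem comp {k : ℕ} {P : (Fin k → ZFSet.{u}) → Prop}
    (h : Dfn U fun v : Fin k → U => P fun i => v i) {a : Fin k → (Fin n → U) → ZFSet.{u}}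
    (ha : ∀ i, DTerm U (a i)) : Dfn U fun v => P fun i => a i v := by
  have key : ∀ (m : ℕ) (l : Fin m → (Fin n → U) → ZFSet.{u}) (hl : ∀ i, DTerm U (l i))
      (Q : (Fin n → U) → (Fin m → U) → Prop)
      (hQ : Dfn U fun v : Fin (n + m) → U =>
        Q (fun i => v (Fin.castAdd m i)) fun i => v (Fin.natAdd n i)),
      Dfn U fun v => Q v fun i => ⟨l i v, (hl i).1 v⟩ := by
    intro m
    induction m with
    | zero =>
      intro l hl Q hQ
      refine hQ.congr fun v => ?_
      congr! 2
    | succ m ihm =>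
      intro l hl Q hQ
      refine (ihm (fun i => l i.castSucc) (fun i => hl _)
        (fun v w => ∃ y : U, (y : ZFSet.{u}) = l (Fin.last m) v ∧ Q v (Fin.snoc w y))
        (Dfn.ex (Dfn.and ?_ ?_))).congr fun v => ?_
      · refine ((hl (Fin.last m)).2.rename
          (Fin.lastCases (Fin.last (n + m)) fun i => (Fin.castAdd m i).castSucc)).congr
            fun v => ?_
        simp only [Fin.lastCases_last]
        congr! 2
        funext i
        simp [Fin.init]
      · refine hQ.congr fun v => ?_
        congr! 2
        rename_i i
        refine Fin.lastCases ?_ (fun i => ?_) i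
        · simp
        · simp [Fin.init]
      · constructor
        · intro hq
          refine ⟨⟨l (Fin.last m) v, (hl _).1 v⟩, rfl, ?_⟩
          convert hq using 2
          rename_i i
          refine Fin.lastCases ?_ (fun i => ?_) i
          · simp
          · simp
        · rintro ⟨y, hy, hq⟩
          convert hq using 2
          rename_i i
          refine Fin.lastCases ?_ (fun i => ?_) i
          · simp [← hy]
          · simp
  exact key k a ha (fun _ w => P fun i => w i) (h.rename (Fin.natAdd n))

theorem comp₂ {P : ZFSet.{u} → ZFSet.{u} → Prop} (h : Dfn U fun v : Fin 2 → U => P (v 0) (v 1))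
    {a b : (Fin n → U) → ZFSet.{u}} (ha : DTerm U a) (hb : DTerm U b) :
    Dfn U fun v => P (a v) (b v) :=
  comp (P := fun w => P (w 0) (w 1)) h (a := ![a, b]) fun i => by
    fin_cases i
    exacts [ha, hb]

theorem comp₃ {P : ZFSet.{u} → ZFSet.{u} → ZFSet.{u} → Prop}
    (h : Dfn U fun v : Fin 3 → U => P (v 0) (v 1) (v 2))
    {a b c : (Fin n → U) → ZFSet.{u}} (ha : DTerm U a) (hb : DTerm U b) (hc : DTerm U c) :
    Dfn U fun v => P (a v) (b v) (c v) :=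
  comp (P := fun w => P (w 0) (w 1) (w 2)) h (a := ![a, b, c]) fun i => by
    fin_cases i
    exacts [ha, hb, hc]

theorem mem {a b : (Fin n → U) → ZFSet.{u}} (ha : DTerm U a) (hb : DTerm U b) :
    Dfn U fun v => a v ∈ b v :=
  comp₂ (P := fun x y => x ∈ y) (mem_var 0 1) ha hb

theorem eq {a b : (Fin n → U) → ZFSet.{u}} (ha : DTerm U a) (hb : DTerm U b) :
    Dfn U fun v => a v = b v :=
  comp₂ (P := fun x y => x = y) (eq_var 0 1) ha hb

end Dfn

theorem DTerm.comp₁ {F : ZFSet.{u} → ZFSet.{u}} (h : DTerm U fun v : Fin 1 → U => F (v 0))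
    {a : (Fin n → U) → ZFSet.{u}} (ha : DTerm U a) : DTerm U fun v => F (a v) :=
  ⟨fun v => h.1 ![⟨a v, ha.1 v⟩],
    Dfn.comp₂ (P := fun x y => y = F x) h.2 ha.init (DTerm.var (Fin.last n))⟩

theorem DTerm.comp₂ {F : ZFSet.{u} → ZFSet.{u} → ZFSet.{u}}
    (h : DTerm U fun v : Fin 2 → U => F (v 0) (v 1))
    {a b : (Fin n → U) → ZFSet.{u}} (ha : DTerm U a) (hb : DTerm U b) :
    DTerm U fun v => F (a v) (b v) :=
  ⟨fun v => h.1 ![⟨a v, ha.1 v⟩, ⟨b v, hb.1 v⟩],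
    Dfn.comp₃ (P := fun x y z => z = F x y) h.2 ha.init hb.init (DTerm.var (Fin.last n))⟩

/-- A definable predicate is given by a formula with finitely many parameters. -/
theorem Dfn.exists_formula [Nonempty U] {Q : (Fin n → U) → Prop} (h : Dfn U Q) :
    ∃ (k : ℕ) (ψ : setLang.Formula (Fin n ⊕ Fin k)) (p : Fin k → U),
      ∀ xs, ψ.Realize (Sum.elim xs p) ↔ Q xs := by
  classical
  obtain ⟨φ, hφ⟩ := h
  let e := φ.toFormula.freeVarFinset.equivFin
  let f : φ.toFormula.freeVarFinset → Fin n ⊕ Fin φ.toFormula.freeVarFinset.card := fun s =>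
    Sum.elim (fun _ => Sum.inr (e s)) Sum.inl s.1
  -- `e` numbers all the free variables that occur, parameters and true variables alike. The slots
  -- of the latter are never read, because `f` sends them to the left, so their value is arbitrary.
  refine ⟨_, BoundedFormula.restrictFreeVar φ.toFormula f,
    fun i => Sum.elim id (fun _ => Classical.arbitrary U) (e.symm i).1, fun xs => ?_⟩
  rw [← hφ]
  refine (BoundedFormula.realize_restrictFreeVar (Sum.elim id xs) ?_).trans ?_
  · rintro ⟨c | j, hs⟩
    · simp [f]
    · simp [f]
  · refine (BoundedFormula.realize_toFormula φ _).trans ?_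
    rfl

/-! ### Sets in a transitive model -/

/-- The image of the set `a` under `F`. -/
noncomputable def imageOf (F : ZFSet.{u} → ZFSet.{u}) (a : ZFSet.{u}) : ZFSet.{u} :=
  ZFSet.range fun x : {x : ZFSet.{u} // x ∈ a} => F x.1

theorem mem_imageOf {F : ZFSet.{u} → ZFSet.{u}} {a y : ZFSet.{u}} :
    y ∈ imageOf F a ↔ ∃ x ∈ a, F x = y := by
  rw [imageOf, ZFSet.mem_range]
  simp

/-- The set of natural numbers. -/
noncomputable def natSet : ZFSet.{u} := ZFSet.range natCode.{u}

theorem mem_natSet {x : ZFSet.{u}} : x ∈ natSet ↔ ∃ m, natCode m = x := by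
  rw [natSet, ZFSet.mem_range]

theorem natCode_mem_natSet (m : ℕ) : natCode.{u} m ∈ natSet := mem_natSet.2 ⟨m, rfl⟩

theorem natCode_zero : natCode.{u} 0 = ∅ := by simp [natCode]

theorem natCode_succ (m : ℕ) : natCode.{u} (m + 1) = insert (natCode m) (natCode m) := by
  simp only [natCode, Nat.cast_add, Nat.cast_one, Ordinal.toZFSet_add_one]

theorem natCode_mem_natCode {j k : ℕ} : natCode.{u} j ∈ natCode k ↔ j < k := by
  simp [natCode, Ordinal.toZFSet_mem_toZFSet_iff]

theorem natCode_injective : Function.Injective natCode.{u} := fun j k h => by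
  simpa using Ordinal.toZFSet_injective h

theorem mem_natCode {x : ZFSet.{u}} {k : ℕ} : x ∈ natCode k ↔ ∃ j < k, natCode j = x := by
  induction k with
  | zero => simp [natCode_zero]
  | succ k ih =>
    rw [natCode_succ, ZFSet.mem_insert_iff, ih]
    constructor
    · rintro (rfl | ⟨j, hj, rfl⟩)
      exacts [⟨k, k.lt_succ_self, rfl⟩, ⟨j, hj.trans k.lt_succ_self, rfl⟩]
    · rintro ⟨j, hj, rfl⟩
      rcases Nat.lt_succ_iff_lt_or_eq.1 hj with h | rfl
      exacts [Or.inr ⟨j, h, rfl⟩, Or.inl rfl]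

namespace IsTransitiveModel

theorem mem_of_mem (hU : IsTransitiveModel U) {x y : ZFSet.{u}} (hy : y ∈ U) (hx : x ∈ y) :
    x ∈ U :=
  hU.transitive y hy x hx

theorem nonempty (hU : IsTransitiveModel U) : Nonempty U :=
  ⟨hU.zfc.infinity.choose⟩

theorem empty_mem (hU : IsTransitiveModel U) : (∅ : ZFSet.{u}) ∈ U := by
  obtain ⟨x, ⟨e, -, he⟩, -⟩ := hU.zfc.infinity
  have : (e : ZFSet.{u}) = ∅ := (ZFSet.eq_empty _).2 fun z hz =>
    he ⟨z, hU.mem_of_mem e.2 hz⟩ hz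
  exact this ▸ e.2

theorem insert_mem (hU : IsTransitiveModel U) {x y : ZFSet.{u}} (hx : x ∈ U) (hy : y ∈ U) :
    insert x y ∈ U := by
  obtain ⟨s, hs⟩ := hU.zfc.pairing ⟨x, hx⟩ ⟨x, hx⟩
  obtain ⟨t, ht⟩ := hU.zfc.pairing s ⟨y, hy⟩
  obtain ⟨w, hw⟩ := hU.zfc.union t
  have : (w : ZFSet.{u}) = insert x y := by
    ext z
    rw [ZFSet.mem_insert_iff]
    constructor
    · intro hz
      obtain ⟨r, hr, hzr⟩ := (hw ⟨z, hU.mem_of_mem w.2 hz⟩).1 hz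
      rcases (ht r).1 hr with rfl | rfl
      · exact Or.inl (by simpa using (hs _).1 hzr)
      · exact Or.inr hzr
    · rintro (rfl | hz)
      · exact (hw ⟨z, hx⟩).2 ⟨s, (ht s).2 (Or.inl rfl), (hs _).2 (Or.inl rfl)⟩
      · exact (hw ⟨z, hU.mem_of_mem hy hz⟩).2 ⟨⟨y, hy⟩, (ht _).2 (Or.inr rfl), hz⟩
  exact this ▸ w.2

theorem pair_mem (hU : IsTransitiveModel U) {x y : ZFSet.{u}} (hx : x ∈ U) (hy : y ∈ U) :
    ZFSet.pair x y ∈ U := by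
  have h1 : ∀ {z}, z ∈ U → ({z} : ZFSet.{u}) ∈ U := fun hz => by
    rw [← LawfulSingleton.insert_empty_eq]
    exact hU.insert_mem hz hU.empty_mem
  exact hU.insert_mem (h1 hx) (h1 (hU.insert_mem hx (h1 hy)))

theorem sUnion_mem (hU : IsTransitiveModel U) {x : ZFSet.{u}} (hx : x ∈ U) :
    ZFSet.sUnion x ∈ U := by
  obtain ⟨w, hw⟩ := hU.zfc.union ⟨x, hx⟩
  have : (w : ZFSet.{u}) = ZFSet.sUnion x := by
    ext z
    rw [ZFSet.mem_sUnion]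
    constructor
    · intro hz
      obtain ⟨r, hr, hzr⟩ := (hw ⟨z, hU.mem_of_mem w.2 hz⟩).1 hz
      exact ⟨r, hr, hzr⟩
    · rintro ⟨r, hr, hzr⟩
      exact (hw ⟨z, hU.mem_of_mem (hU.mem_of_mem hx hr) hzr⟩).2
        ⟨⟨r, hU.mem_of_mem hx hr⟩, hr, hzr⟩
  exact this ▸ w.2

theorem union_mem (hU : IsTransitiveModel U) {x y : ZFSet.{u}} (hx : x ∈ U) (hy : y ∈ U) :
    x ∪ y ∈ U := by
  have h := hU.sUnion_mem (hU.insert_mem hx (hU.insert_mem hy hU.empty_mem))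
  convert h using 1
  ext z
  simp

theorem natCode_mem (hU : IsTransitiveModel U) (m : ℕ) : natCode m ∈ U := by
  induction m with
  | zero => exact natCode_zero ▸ hU.empty_mem
  | succ m ih => exact natCode_succ.{u} m ▸ hU.insert_mem ih ih

end IsTransitiveModel

/-! ### Definability in a transitive model -/

theorem Dfn.exMem (hU : IsTransitiveModel U) {a : (Fin n → U) → ZFSet.{u}}
    {Q : (Fin n → U) → ZFSet.{u} → Prop} (ha : DTerm U a)
    (h : Dfn U fun v : Fin (n + 1) → U => Q (Fin.init v) (v (Fin.last n))) :
    Dfn U fun v => ∃ x ∈ a v, Q v x := by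
  refine Dfn.congr (Q := fun v => ∃ x : U, (x : ZFSet.{u}) ∈ a v ∧ Q v x)
    (Dfn.ex (Dfn.and (Dfn.mem (DTerm.var (Fin.last n)) ha.init) h)) fun v => ?_
  constructor
  · rintro ⟨x, hx, hq⟩
    exact ⟨⟨x, hU.mem_of_mem (ha.1 v) hx⟩, hx, hq⟩
  · rintro ⟨x, hx, hq⟩
    exact ⟨x, hx, hq⟩

theorem Dfn.allMem (hU : IsTransitiveModel U) {a : (Fin n → U) → ZFSet.{u}}
    {Q : (Fin n → U) → ZFSet.{u} → Prop} (ha : DTerm U a)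
    (h : Dfn U fun v : Fin (n + 1) → U => Q (Fin.init v) (v (Fin.last n))) :
    Dfn U fun v => ∀ x ∈ a v, Q v x := by
  refine Dfn.congr (Q := fun v => ∀ x : U, (x : ZFSet.{u}) ∈ a v → Q v x)
    (Dfn.all (Dfn.imp (Dfn.mem (DTerm.var (Fin.last n)) ha.init) h)) fun v => ?_
  constructor
  · intro H x hx
    exact H _ hx
  · intro H x hx
    exact H ⟨x, hU.mem_of_mem (ha.1 v) hx⟩ hx

/-- A function is definable if membership in its values is. -/
theorem DTerm.of_mem (hU : IsTransitiveModel U) {a : (Fin n → U) → ZFSet.{u}}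
    (h1 : ∀ v, a v ∈ U)
    (h2 : Dfn U fun v : Fin (n + 1) → U => (v (Fin.last n) : ZFSet.{u}) ∈ a (Fin.init v)) :
    DTerm U a := by
  refine ⟨h1, ?_⟩
  have h3 := h2.rename (m := n + 1 + 1)
    (Fin.lastCases (Fin.last (n + 1)) fun i => (Fin.castSucc i).castSucc)
  simp only [Fin.lastCases_last] at h3
  -- Extensionality: by transitivity, two elements of `U` are equal once they have the same elements
  -- in `U`.
  refine Dfn.congr (Q := fun v : Fin (n + 1) → U => ∀ x : U,
    ((x : ZFSet.{u}) ∈ (v (Fin.last n) : ZFSet.{u}) ↔ (x : ZFSet.{u}) ∈ a (Fin.init v)))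
    (Dfn.all (Dfn.iff (Dfn.mem_var (Fin.last (n + 1)) (Fin.last n).castSucc) ?_)) fun v => ?_
  · refine h3.congr fun v => ?_
    congr! 2
    funext i
    simp [Fin.init]
  · constructor
    · intro h x
      rw [h]
    · intro h
      ext x
      exact ⟨fun hx => (h ⟨x, hU.mem_of_mem (v (Fin.last n)).2 hx⟩).1 hx,
        fun hx => (h ⟨x, hU.mem_of_mem (h1 _) hx⟩).2 hx⟩

theorem DTerm.insert (hU : IsTransitiveModel U) {a b : (Fin n → U) → ZFSet.{u}}
    (ha : DTerm U a) (hb : DTerm U b) :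
    DTerm U fun v => (Insert.insert (a v) (b v) : ZFSet.{u}) := by
  refine DTerm.comp₂ (F := fun x y => Insert.insert x y) ?_ ha hb
  refine DTerm.of_mem hU (fun v => hU.insert_mem (v 0).2 (v 1).2) ?_
  exact (Dfn.or (Dfn.eq_var 2 0) (Dfn.mem_var 2 1)).congr fun v => ZFSet.mem_insert_iff

theorem DTerm.pair (hU : IsTransitiveModel U) {a b : (Fin n → U) → ZFSet.{u}}
    (ha : DTerm U a) (hb : DTerm U b) : DTerm U fun v => ZFSet.pair (a v) (b v) := by
  have h1 : ∀ {c : (Fin n → U) → ZFSet.{u}}, DTerm U c →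
      DTerm U fun v => ({c v} : ZFSet.{u}) := fun hc => by
    simp only [← LawfulSingleton.insert_empty_eq (α := ZFSet.{u})]
    exact hc.insert hU (DTerm.const hU.empty_mem)
  exact (h1 ha).insert hU (h1 (ha.insert hU (h1 hb)))

namespace IsTransitiveModel

theorem sep_mem (hU : IsTransitiveModel U) {a : ZFSet.{u}} (ha : a ∈ U) {Q : ZFSet.{u} → Prop}
    (h : Dfn U fun v : Fin 1 → U => Q (v 0)) : a.sep Q ∈ U := by
  have := hU.nonempty
  obtain ⟨k, ψ, p, hψ⟩ := h.exists_formula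
  obtain ⟨b, hb⟩ := hU.zfc.separation k
    (ψ.relabel (Sum.elim (fun _ => 0) Fin.succ)) p ⟨a, ha⟩
  have : (b : ZFSet.{u}) = a.sep Q := by
    ext x
    rw [ZFSet.mem_sep]
    have key : ∀ hx : x ∈ U, x ∈ (b : ZFSet.{u}) ↔ x ∈ a ∧ Q x := by
      intro hx
      refine (hb ⟨x, hx⟩).trans (and_congr Iff.rfl ?_)
      rw [Formula.realize_relabel]
      refine Iff.trans ?_ (hψ fun _ => ⟨x, hx⟩)
      refine iff_of_eq (congrArg _ (funext ?_))
      rintro (i | i) <;> rfl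
    exact ⟨fun hx => (key (hU.mem_of_mem b.2 hx)).1 hx,
      fun hx => (key (hU.mem_of_mem ha hx.1)).2 hx⟩
  exact this ▸ b.2

/-- The replacement axiom wants a value for every element of the domain. Separation first cuts `a`
down to the part `a'` where `Q` has a value in `U`, so a partial function suffices. -/
theorem exists_replacement (hU : IsTransitiveModel U) {a : ZFSet.{u}} (ha : a ∈ U)
    {Q : ZFSet.{u} → ZFSet.{u} → Prop} (h : Dfn U fun v : Fin 2 → U => Q (v 0) (v 1))
    (hQ : ∀ x ∈ a, ∀ y ∈ U, ∀ y' ∈ U, Q x y → Q x y' → y = y') :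
    ∃ b ∈ U, ∀ y, y ∈ b ↔ y ∈ U ∧ ∃ x ∈ a, Q x y := by
  have := hU.nonempty
  let a' : ZFSet.{u} := a.sep fun x => ∃ y : U, Q x y
  have ha' : a' ∈ U := hU.sep_mem ha (Dfn.ex (Dfn.comp₂ h (DTerm.var _) (DTerm.var _)))
  have hmem : ∀ x : U, E x ⟨a', ha'⟩ ↔ (x : ZFSet.{u}) ∈ a ∧ ∃ y : U, Q x y := fun x => by
    exact ZFSet.mem_sep (p := fun x => ∃ y : U, Q x y)
  obtain ⟨k, ψ, p, hψ⟩ := h.exists_formula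
  have key : ∀ x y : U, (ψ.relabel (Sum.elim ![0, 1] fun i => i.succ.succ)).Realize
      (Matrix.vecCons x (Matrix.vecCons y p)) ↔ Q x y := by
    intro x y
    rw [Formula.realize_relabel]
    refine Iff.trans ?_ (hψ ![x, y])
    refine iff_of_eq (congrArg _ (funext ?_))
    rintro (i | i)
    · fin_cases i <;> rfl
    · rfl
  obtain ⟨b, hb⟩ := hU.zfc.replacement k (ψ.relabel (Sum.elim ![0, 1] fun i => i.succ.succ)) p
    ⟨a', ha'⟩ fun x hx => by
      obtain ⟨hxa, y, hy⟩ := (hmem x).1 hx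
      refine ⟨y, (key x y).2 hy, fun y' hy' => ?_⟩
      exact Subtype.ext (hQ x hxa y' y'.2 y y.2 ((key x y').1 hy') hy)
  refine ⟨b, b.2, fun y => ⟨fun hy => ?_, ?_⟩⟩
  · have hyU := hU.mem_of_mem b.2 hy
    obtain ⟨x, hx, hxy⟩ := (hb ⟨y, hyU⟩).1 hy
    exact ⟨hyU, x, ((hmem x).1 hx).1, (key _ _).1 hxy⟩
  · rintro ⟨hyU, x, hx, hxy⟩
    exact (hb ⟨y, hyU⟩).2 ⟨⟨x, hU.mem_of_mem ha hx⟩,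
      (hmem _).2 ⟨hx, ⟨y, hyU⟩, hxy⟩, (key ⟨x, hU.mem_of_mem ha hx⟩ ⟨y, hyU⟩).2 hxy⟩

theorem imageOf_mem (hU : IsTransitiveModel U) {a : ZFSet.{u}} (ha : a ∈ U)
    {F : ZFSet.{u} → ZFSet.{u}} (h : DTerm U fun v : Fin 1 → U => F (v 0)) :
    imageOf F a ∈ U := by
  obtain ⟨b, hbU, hb⟩ := hU.exists_replacement ha (Q := fun x y => y = F x) h.2
    fun x _ y _ y' _ h h' => h.trans h'.symm
  have : b = imageOf F a := by
    ext y
    rw [hb, mem_imageOf]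
    constructor
    · rintro ⟨-, x, hx, rfl⟩
      exact ⟨x, hx, rfl⟩
    · rintro ⟨x, hx, rfl⟩
      exact ⟨h.1 ![⟨x, hU.mem_of_mem ha hx⟩], x, hx, rfl⟩
  exact this ▸ hbU

theorem prod_mem (hU : IsTransitiveModel U) {a b : ZFSet.{u}} (ha : a ∈ U) (hb : b ∈ U) :
    a.prod b ∈ U := by
  have h1 : DTerm U fun v : Fin 1 → U => imageOf (fun y => ZFSet.pair (v 0) y) b := by
    refine DTerm.of_mem hU (fun v => hU.imageOf_mem hb ?_) ?_
    · exact DTerm.pair hU (DTerm.const (v 0).2) (DTerm.var 0)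
    · refine (Dfn.exMem hU (Q := fun v y => ZFSet.pair (v 0) y = v 1) (DTerm.const hb)
        (Dfn.eq (DTerm.pair hU (DTerm.var 0) (DTerm.var 2)) (DTerm.var 1))).congr fun v => ?_
      exact mem_imageOf
  have h2 := hU.sUnion_mem (hU.imageOf_mem ha
    (F := fun x => imageOf (fun y => ZFSet.pair x y) b) h1)
  convert h2 using 1
  ext z
  simp only [ZFSet.mem_prod, ZFSet.mem_sUnion, mem_imageOf]
  constructor
  · rintro ⟨x, hx, y, hy, rfl⟩
    exact ⟨_, ⟨x, hx, rfl⟩, mem_imageOf.2 ⟨y, hy, rfl⟩⟩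
  · rintro ⟨_, ⟨x, hx, rfl⟩, h⟩
    obtain ⟨y, hy, rfl⟩ := mem_imageOf.1 h
    exact ⟨x, hx, y, hy, rfl⟩

theorem exists_powerset (hU : IsTransitiveModel U) {a : ZFSet.{u}} (ha : a ∈ U) :
    ∃ b ∈ U, ∀ x ∈ U, x ∈ b ↔ x ⊆ a := by
  obtain ⟨b, hb⟩ := hU.zfc.powerset ⟨a, ha⟩
  refine ⟨b, b.2, fun x hx => (hb ⟨x, hx⟩).trans ⟨fun h z hz => ?_, fun h z hz => h hz⟩⟩
  exact h ⟨z, hU.mem_of_mem hx hz⟩ hz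

/-- The axiom of infinity gives some inductive `x`, possibly too large. The part `w` of `x` common
to all inductive sets of `U` is the right one: an `∈`-minimal element of `w` that is not a natural
number is neither empty nor the successor of an element of `w`, so it could be removed. -/
theorem natSet_mem (hU : IsTransitiveModel U) : natSet ∈ U := by
  obtain ⟨⟨x, hx⟩, ⟨e, hex, he⟩, hs⟩ := hU.zfc.infinity
  have hsucc : ∀ t ∈ x, insert t t ∈ x := by
    intro t htx
    obtain ⟨y', hy', h⟩ := hs ⟨t, hU.mem_of_mem hx htx⟩ htx
    have : (y' : ZFSet.{u}) = insert t t := by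
      ext r
      rw [ZFSet.mem_insert_iff]
      constructor
      · intro hr
        rcases (h ⟨r, hU.mem_of_mem y'.2 hr⟩).1 hr with h | h
        exacts [Or.inr h, Or.inl (congrArg Subtype.val h)]
      · rintro (rfl | hr)
        · exact (h ⟨_, hU.mem_of_mem hx htx⟩).2 (Or.inr rfl)
        · exact (h ⟨r, hU.mem_of_mem (hU.mem_of_mem hx htx) hr⟩).2 (Or.inl hr)
    exact this ▸ hy'
  have hind : ∀ m, natCode m ∈ x := by
    intro m
    induction m with
    | zero =>
      rw [natCode_zero]
      have : (e : ZFSet.{u}) = ∅ := (ZFSet.eq_empty _).2 fun z hz =>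
        he ⟨z, hU.mem_of_mem e.2 hz⟩ hz
      exact this ▸ hex
    | succ m ih =>
      exact natCode_succ.{u} m ▸ hsucc _ ih
  -- A natural number is an element of every inductive set.
  let Ind : ZFSet.{u} → Prop := fun y => ∅ ∈ y ∧ ∀ z ∈ y, insert z z ∈ y
  have hInd : Dfn U fun v : Fin 2 → U => Ind (v 1) :=
    Dfn.and (Dfn.mem (DTerm.const hU.empty_mem) (DTerm.var 1))
      (Dfn.allMem hU (Q := fun v z => insert z z ∈ (v 1 : ZFSet.{u})) (DTerm.var 1)
        (Dfn.mem (DTerm.insert hU (DTerm.var 2) (DTerm.var 2)) (DTerm.var 1)))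
  have hw := hU.sep_mem hx (Q := fun z => ∀ y : U, Ind y → z ∈ (y : ZFSet.{u}))
    (Dfn.all (Dfn.imp hInd (Dfn.mem_var 0 1)))
  set w := ZFSet.sep (fun z => ∀ y : U, Ind y → z ∈ (y : ZFSet.{u})) x with hwdef
  have hnat : ∀ y, Ind y → ∀ m, natCode m ∈ y := by
    intro y hy m
    induction m with
    | zero => exact natCode_zero ▸ hy.1
    | succ m ih => exact natCode_succ.{u} m ▸ hy.2 _ ih
  have : w = natSet := by
    ext z
    rw [mem_natSet]
    constructor
    · induction z using ZFSet.inductionOn with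
      | _ z ih =>
      intro hz
      by_contra hne
      have hz' := (ZFSet.mem_sep.1 hz).2
      -- Removing `z` from `w` leaves an inductive set.
      have hq : w.sep (fun t => ¬ t = z) ∈ U :=
        hU.sep_mem hw (Dfn.not (Dfn.eq (DTerm.var 0)
          (DTerm.const (hU.mem_of_mem hw hz))))
      have hI : Ind (w.sep fun t => ¬ t = z) := by
        constructor
        · refine ZFSet.mem_sep.2 ⟨ZFSet.mem_sep.2 ⟨natCode_zero.{u} ▸ hind 0,
            fun y hy => hy.1⟩, ?_⟩
          rintro rfl
          exact hne ⟨0, natCode_zero⟩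
        · intro t ht
          obtain ⟨htw, -⟩ := ZFSet.mem_sep.1 ht
          obtain ⟨htx, ht'⟩ := ZFSet.mem_sep.1 htw
          refine ZFSet.mem_sep.2 ⟨ZFSet.mem_sep.2 ⟨?_, fun y hy => hy.2 _ (ht' y hy)⟩, ?_⟩
          · exact hsucc t htx
          · rintro rfl
            obtain ⟨m, rfl⟩ := ih t (ZFSet.mem_insert _ _) htw
            exact hne ⟨m + 1, natCode_succ m⟩
      exact (ZFSet.mem_sep.1 (show z ∈ w.sep fun t => ¬ t = z from hz' ⟨_, hq⟩ hI)).2 rfl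
    · rintro ⟨m, rfl⟩
      exact ZFSet.mem_sep.2 ⟨hind m, fun y hy => hnat _ hy m⟩
  exact this ▸ hw

end IsTransitiveModel

/-- Definition of a function `f` by recursion along a transitive relation `R`, with a parameter:
`f p a = B p a ∪ {T (f p x) | x ∈ A, R x a}`. The relation is well-founded in the sense that
induction along it is valid. -/
theorem IsTransitiveModel.exists_recursion (hU : IsTransitiveModel U) {A : ZFSet.{u}} (hA : A ∈ U)
    {R : ZFSet.{u} → ZFSet.{u} → Prop} (hR : Dfn U fun v : Fin 2 → U => R (v 0) (v 1))
    (htrans : ∀ x ∈ A, ∀ y ∈ A, ∀ z ∈ A, R x y → R y z → R x z)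
    (hind : ∀ P : ZFSet.{u} → Prop, (∀ a ∈ A, (∀ x ∈ A, R x a → P x) → P a) → ∀ a ∈ A, P a)
    {B : ZFSet.{u} → ZFSet.{u} → ZFSet.{u}} (hB : DTerm U fun v : Fin 2 → U => B (v 0) (v 1))
    {T : ZFSet.{u} → ZFSet.{u}} (hT : DTerm U fun v : Fin 1 → U => T (v 0)) :
    ∃ f : ZFSet.{u} → ZFSet.{u} → ZFSet.{u}, DTerm U (fun v : Fin 2 → U => f (v 0) (v 1)) ∧
      ∀ p ∈ U, ∀ a ∈ A, ∀ z, z ∈ f p a ↔ z ∈ B p a ∨ ∃ x ∈ A, R x a ∧ z = T (f p x) := by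
  have hirr : ∀ a ∈ A, ¬ R a a := hind _ fun a ha ih h => ih a ha h h
  -- Approximations to the function with parameter `p`.
  let good : ZFSet.{u} → ZFSet.{u} → Prop := fun p g => ∀ a ∈ A, ∀ y : U, ZFSet.pair a y ∈ g →
    (∀ x ∈ A, R x a → ∃ y' : U, ZFSet.pair x y' ∈ g) ∧
    ∀ z : U, (z : ZFSet.{u}) ∈ (y : ZFSet.{u}) ↔ (z : ZFSet.{u}) ∈ B p a ∨
      ∃ x ∈ A, R x a ∧ ∃ y' : U, ZFSet.pair x y' ∈ g ∧ (z : ZFSet.{u}) = T y'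
  have hgood : Dfn U fun v : Fin 2 → U => good (v 0) (v 1) := by
    have hA' : ∀ m, DTerm U fun _ : Fin m → U => A := fun m => DTerm.const hA
    repeat' first
      | exact DTerm.var _
      | exact hA' _
      | refine Dfn.comp₂ hR ?_ ?_
      | refine Dfn.mem ?_ (DTerm.comp₂ hB ?_ ?_)
      | refine Dfn.eq ?_ (DTerm.comp₁ hT ?_)
      | refine Dfn.mem (DTerm.pair hU ?_ ?_) ?_
      | refine Dfn.allMem hU ?_ ?_
      | refine Dfn.exMem hU ?_ ?_
      | refine Dfn.all ?_
      | refine Dfn.ex ?_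
      | refine Dfn.imp ?_ ?_
      | refine Dfn.iff ?_ ?_
      | refine Dfn.and ?_ ?_
      | refine Dfn.or ?_ ?_
      | refine Dfn.mem ?_ ?_
  -- Two approximations agree wherever both are defined, by induction along `R`.
  have huniq : ∀ p, ∀ a ∈ A, ∀ (g g' : ZFSet.{u}) (y y' : U), good p g → good p g' →
      ZFSet.pair a y ∈ g → ZFSet.pair a y' ∈ g' → y = y' := by
    intro p
    refine hind _ fun a ha ih => ?_
    have sub : ∀ (g g' : ZFSet.{u}) (y y' : U), good p g → good p g' →
        ZFSet.pair a y ∈ g → ZFSet.pair a y' ∈ g' → (y : ZFSet.{u}) ⊆ y' := by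
      intro g g' y y' hg hg' hy hy' z hz
      have hzU := hU.mem_of_mem y.2 hz
      obtain ⟨-, h2⟩ := hg a ha y hy
      obtain ⟨h1', h2'⟩ := hg' a ha y' hy'
      refine (h2' ⟨z, hzU⟩).2 (((h2 ⟨z, hzU⟩).1 hz).imp_right ?_)
      rintro ⟨x, hx, hxa, w, hw, hzw⟩
      obtain ⟨w', hw'⟩ := h1' x hx hxa
      exact ⟨x, hx, hxa, w', hw', by rw [← ih x hx hxa g g' w w' hg hg' hw hw']; exact hzw⟩
    intro g g' y y' hg hg' hy hy'
    exact Subtype.ext (LE.le.antisymm (sub g g' y y' hg hg' hy hy')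
      (sub g' g y' y hg' hg hy' hy))
  let Y : ZFSet.{u} → ZFSet.{u} → ZFSet.{u} → Prop := fun p a y =>
    ∃ g : U, good p g ∧ ZFSet.pair a y ∈ (g : ZFSet.{u})
  have hYdfn : Dfn U fun v : Fin 3 → U => Y (v 0) (v 1) (v 2) :=
    Dfn.ex (Dfn.and (Dfn.comp₂ hgood (DTerm.var _) (DTerm.var _))
      (Dfn.mem (DTerm.pair hU (DTerm.var _) (DTerm.var _)) (DTerm.var _)))
  have hYuniq : ∀ p, ∀ a ∈ A, ∀ y y' : U, Y p a y → Y p a y' → y = y' := by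
    rintro p a ha y y' ⟨g, hg, hy⟩ ⟨g', hg', hy'⟩
    exact huniq p a ha g g' y y' hg hg' hy hy'
  have hY : ∀ p, ∀ a ∈ A, ∀ y : U, Y p a y → (∀ x ∈ A, R x a → ∃ y' : U, Y p x y') ∧
      ∀ z : U, (z : ZFSet.{u}) ∈ (y : ZFSet.{u}) ↔ (z : ZFSet.{u}) ∈ B p a ∨
        ∃ x ∈ A, R x a ∧ ∃ y' : U, Y p x y' ∧ (z : ZFSet.{u}) = T y' := by
    rintro p a ha y ⟨g, hg, hy⟩
    obtain ⟨h1, h2⟩ := hg a ha y hy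
    refine ⟨fun x hx hxa => ?_, fun z => (h2 z).trans (or_congr Iff.rfl ?_)⟩
    · obtain ⟨y', hy'⟩ := h1 x hx hxa
      exact ⟨y', g, hg, hy'⟩
    · constructor
      · rintro ⟨x, hx, hxa, y', hy', hz⟩
        exact ⟨x, hx, hxa, y', ⟨g, hg, hy'⟩, hz⟩
      · rintro ⟨x, hx, hxa, y', hy', hz⟩
        obtain ⟨y'', hy''⟩ := h1 x hx hxa
        rw [← hYuniq p x hx y'' y' ⟨g, hg, hy''⟩ hy'] at hz
        exact ⟨x, hx, hxa, y'', hy'', hz⟩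
  have hTU : ∀ y : U, T y ∈ U := fun y => hT.1 ![y]
  have hYex : ∀ p ∈ U, ∀ a ∈ A, ∃ y : U, Y p a y := by
    intro p hp
    refine hind _ fun a ha ih => ?_
    have haU := hU.mem_of_mem hA ha
    have hpc : ∀ m, DTerm U fun _ : Fin m → U => p := fun m => DTerm.const hp
    have hS : A.sep (fun x => R x a) ∈ U :=
      hU.sep_mem hA (Dfn.comp₂ hR (DTerm.var _) (DTerm.const haU))
    -- `b` is the graph of the function on the predecessors of `a`, and `c` collects the images
    -- under `T` of its values. The approximation `g` reaching `a` is `b` with the one pair `(a, B p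
    -- a ∪ c)` added; irreflexivity of `R` keeps this pair apart from `b`.
    obtain ⟨b, hbU, hb⟩ := hU.exists_replacement hS
      (Q := fun x w => ∃ y : U, Y p x y ∧ w = ZFSet.pair x y)
      (Dfn.ex (Dfn.and (Dfn.comp₃ hYdfn (hpc _) (DTerm.var _) (DTerm.var _))
        (Dfn.eq (DTerm.var _) (DTerm.pair hU (DTerm.var _) (DTerm.var _))))) (by
        rintro x hx _ - _ - ⟨y, hy, rfl⟩ ⟨y', hy', rfl⟩
        rw [hYuniq p x (ZFSet.mem_sep.1 hx).1 y y' hy hy'])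
    obtain ⟨c, hcU, hc⟩ := hU.exists_replacement hS
      (Q := fun x w => ∃ y : U, Y p x y ∧ w = T y)
      (Dfn.ex (Dfn.and (Dfn.comp₃ hYdfn (hpc _) (DTerm.var _) (DTerm.var _))
        (Dfn.eq (DTerm.var _) (DTerm.comp₁ hT (DTerm.var _))))) (by
        rintro x hx _ - _ - ⟨y, hy, rfl⟩ ⟨y', hy', rfl⟩
        rw [hYuniq p x (ZFSet.mem_sep.1 hx).1 y y' hy hy'])
    let ya : U := ⟨B p a ∪ c, hU.union_mem (hB.1 ![⟨p, hp⟩, ⟨a, haU⟩]) hcU⟩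
    let g : U := ⟨insert (ZFSet.pair a ya) b, hU.insert_mem (hU.pair_mem haU ya.2) hbU⟩
    have hg1 : ∀ (x : ZFSet.{u}) (y : U), ZFSet.pair x y ∈ (g : ZFSet.{u}) ↔
        (x = a ∧ y = ya) ∨ (x ∈ A ∧ R x a ∧ Y p x y) := by
      intro x y
      refine ZFSet.mem_insert_iff.trans (or_congr ?_ ?_)
      · rw [ZFSet.pair_inj, Subtype.ext_iff]
      · rw [hb]
        constructor
        · rintro ⟨-, x', hx', y', hy', h⟩
          obtain ⟨rfl, hyy⟩ := ZFSet.pair_inj.1 h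
          obtain rfl : y = y' := Subtype.ext hyy
          exact ⟨(ZFSet.mem_sep.1 hx').1, (ZFSet.mem_sep.1 hx').2, hy'⟩
        · rintro ⟨hx, hxa, hy⟩
          exact ⟨hU.pair_mem (hU.mem_of_mem hA hx) y.2, x, ZFSet.mem_sep.2 ⟨hx, hxa⟩, y, hy, rfl⟩
    have hg2 : ∀ x ∈ A, R x a → ∀ y : U, ZFSet.pair x y ∈ (g : ZFSet.{u}) ↔ Y p x y := by
      intro x hx hxa y
      rw [hg1]
      constructor
      · rintro (⟨rfl, -⟩ | h)
        exacts [(hirr x hx hxa).elim, h.2.2]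
      · exact fun h => Or.inr ⟨hx, hxa, h⟩
    refine ⟨ya, g, fun a' ha' y hy => ?_, (hg1 _ _).2 (Or.inl ⟨rfl, rfl⟩)⟩
    -- Transitivity of `R` makes the domain of `g` closed under predecessors.
    have hle : ∀ x ∈ A, R x a' → R x a := by
      intro x hx hxa'
      rcases (hg1 _ _).1 hy with ⟨rfl, -⟩ | h
      exacts [hxa', htrans x hx a' ha' a ha hxa' h.2.1]
    suffices h : (∀ x ∈ A, R x a' → ∃ y' : U, Y p x y') ∧
        ∀ z : U, (z : ZFSet.{u}) ∈ (y : ZFSet.{u}) ↔ (z : ZFSet.{u}) ∈ B p a' ∨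
          ∃ x ∈ A, R x a' ∧ ∃ y' : U, Y p x y' ∧ (z : ZFSet.{u}) = T y' by
      refine ⟨fun x hx hxa => ?_, fun z => (h.2 z).trans (or_congr Iff.rfl ?_)⟩
      · obtain ⟨y', hy'⟩ := h.1 x hx hxa
        exact ⟨y', (hg2 x hx (hle x hx hxa) y').2 hy'⟩
      · refine exists_congr fun x => and_congr_right fun hx => and_congr_right fun hxa => ?_
        exact exists_congr fun y' => and_congr (hg2 x hx (hle x hx hxa) y').symm Iff.rfl
    rcases (hg1 _ _).1 hy with ⟨rfl, rfl⟩ | h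
    · refine ⟨ih, fun z => ?_⟩
      refine ZFSet.mem_union.trans (or_congr Iff.rfl ?_)
      rw [hc]
      constructor
      · rintro ⟨-, x, hx, h⟩
        exact ⟨x, (ZFSet.mem_sep.1 hx).1, (ZFSet.mem_sep.1 hx).2, h⟩
      · rintro ⟨x, hx, hxa, h⟩
        exact ⟨z.2, x, ZFSet.mem_sep.2 ⟨hx, hxa⟩, h⟩
    · exact hY p a' ha' y h.2.2
  classical
  have := hU.nonempty
  choose! F hF using hYex
  have hf : ∀ p ∈ U, ∀ a ∈ A, ∀ y : U, Y p a y ↔ y = F p a := fun p hp a ha y =>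
    ⟨fun h => hYuniq p a ha _ _ h (hF p hp a ha), fun h => h ▸ hF p hp a ha⟩
  -- The default `∅` off `A` makes the function total with values in `U`, as `DTerm` demands.
  refine ⟨fun p a => if a ∈ A then F p a else ∅, ?_, fun p hp a ha z => ?_⟩
  · refine DTerm.of_mem hU (fun v => ?_) ?_
    · dsimp only
      split_ifs
      exacts [(F _ _).2, hU.empty_mem]
    · refine Dfn.congr (Q := fun v : Fin 3 → U => (v 1 : ZFSet.{u}) ∈ A ∧
        ∃ y : U, Y (v 0) (v 1) y ∧ (v 2 : ZFSet.{u}) ∈ (y : ZFSet.{u}))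
        (Dfn.and (Dfn.mem (DTerm.var _) (DTerm.const hA)) (Dfn.ex (Dfn.and
          (Dfn.comp₃ hYdfn (DTerm.var _) (DTerm.var _) (DTerm.var _))
          (Dfn.mem (DTerm.var _) (DTerm.var _))))) fun v => ?_
      change ((v 2 : ZFSet.{u}) ∈ (if (v 1 : ZFSet.{u}) ∈ A then _ else _)) ↔ _
      split_ifs with h
      · refine Iff.trans ?_ (and_iff_right h).symm
        constructor
        · exact fun hv => ⟨_, hF _ (v 0).2 _ h, hv⟩
        · rintro ⟨y, hy, hv⟩
          rw [(hf _ (v 0).2 _ h y).1 hy] at hv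
          exact hv
      · simp [h]
  · beta_reduce
    rw [if_pos ha]
    have h2 := (hY p a ha _ (hF p hp a ha)).2
    have e : (∃ x ∈ A, R x a ∧ z = T (if x ∈ A then (F p x : ZFSet.{u}) else ∅)) ↔
        ∃ x ∈ A, R x a ∧ ∃ y' : U, Y p x y' ∧ z = T y' := by
      refine exists_congr fun x => and_congr_right fun hx => and_congr_right fun _ => ?_
      rw [if_pos hx]
      constructor
      · exact fun h => ⟨_, hF p hp x hx, h⟩
      · rintro ⟨y, hy, h⟩
        rw [(hf p hp x hx y).1 hy] at h
        exact h
    rw [e]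
    constructor
    · exact fun hz => (h2 ⟨z, hU.mem_of_mem (F p a).2 hz⟩).1 hz
    · intro hz
      have hzU : z ∈ U := by
        rcases hz with hz | ⟨x, hx, -, y, -, rfl⟩
        · exact hU.mem_of_mem (hB.1 ![⟨p, hp⟩, ⟨a, hU.mem_of_mem hA ha⟩]) hz
        · exact hTU y
      exact (h2 ⟨z, hzU⟩).2 hz

/-! ### Coding into reals with prescribed genericity -/

/-- The first `true` value of `d` after position `m` is at distance `j + 1`. -/
def NextOne (d : ℕ → Bool) (m j : ℕ) : Prop :=
  d (m + 1 + j) = true ∧ ∀ j' < j, d (m + 1 + j') = false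

theorem NextOne.unique {d : ℕ → Bool} {m j j' : ℕ} (h : NextOne d m j) (h' : NextOne d m j') :
    j = j' := by
  rcases lt_trichotomy j j' with hlt | rfl | hlt
  · have := h'.2 j hlt
    rw [h.1] at this
    cases this
  · rfl
  · have := h.2 j' hlt
    rw [h'.1] at this
    cases this

theorem NextOne.congr {d d' : ℕ → Bool} {m j L : ℕ} (h : NextOne d m j) (hL : m + 1 + j < L)
    (hd : ∀ x < L, d' x = d x) : NextOne d' m j :=
  ⟨by rw [hd _ hL, h.1], fun j' hj' => by rw [hd _ (by omega), h.2 j' hj']⟩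

/-- One step of the construction of `exists_coding`. -/
theorem exists_coding_step {ι : Type*} {a b : ι} (hab : a ≠ b) {O : Set (ι → ℕ → Bool)}
    (hopen : ∀ d ∈ O, ∃ L : ℕ, ∀ d' : ι → ℕ → Bool, (∀ i, ∀ x < L, d' i x = d i x) → d' ∈ O)
    (hdense : ∃ i₀, ∀ (L : ℕ) (d : ι → ℕ → Bool), ∃ d' ∈ O,
      (∀ i, ∀ x < L, d' i x = d i x) ∧ ∀ x ≥ L, d' i₀ x = false)
    {J K : ℕ} (hJK : J ≠ K) (L : ℕ) (d : ι → ℕ → Bool) :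
    ∃ (m L' : ℕ) (d' : ι → ℕ → Bool), L ≤ m ∧ m + 1 + J < L' ∧ m + 1 + K < L' ∧
      (∀ i, ∀ x < L, d' i x = d i x) ∧
      (∀ e : ι → ℕ → Bool, (∀ i, ∀ x < L', e i x = d' i x) → e ∈ O) ∧
      (∀ i, d' i m = true) ∧ NextOne (d' a) m J ∧ NextOne (d' b) m K ∧
      ∀ x, L ≤ x → x < L' → (∀ i, d' i x = true) → x = m := by
  classical
  obtain ⟨i₀, h⟩ := hdense
  obtain ⟨d₁, hd₁, hagree, hzero⟩ := h L d
  obtain ⟨L₁, hL₁⟩ := hopen d₁ hd₁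
  -- Beyond `L₁` the values no longer affect membership in `O`, so the mark can be placed at `m`.
  obtain ⟨m, hm, hm₁⟩ : ∃ m, L ≤ m ∧ L₁ ≤ m := ⟨max L L₁, le_max_left _ _, le_max_right _ _⟩
  let d' : ι → ℕ → Bool := fun i x =>
    if x < m then d₁ i x else if x = m then true else
      if i = a then decide (x = m + 1 + J) else if i = b then decide (x = m + 1 + K) else false
  have hlt : ∀ i, ∀ x < m, d' i x = d₁ i x := fun i x hx => if_pos hx
  have heq : ∀ i, d' i m = true := fun i => by simp [d']
  have ha : ∀ j, d' a (m + 1 + j) = decide (j = J) := fun j => by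
    have h1 : ¬ m + 1 + j < m := by omega
    have h2 : ¬ m + 1 + j = m := by omega
    simp [d', h1, h2]
  have hb : ∀ j, d' b (m + 1 + j) = decide (j = K) := fun j => by
    have h1 : ¬ m + 1 + j < m := by omega
    have h2 : ¬ m + 1 + j = m := by omega
    simp [d', h1, h2, hab.symm]
  -- The length `m + 2 + J + K` passes both `m + 1 + J` and `m + 1 + K`, and also `L₁`.
  refine ⟨m, m + 2 + J + K, d', hm, by omega, by omega, fun i x hx => ?_, fun e he => ?_, heq,
    ⟨by simp [ha], fun j hj => by simp [ha, hj.ne]⟩,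
    ⟨by simp [hb], fun j hj => by simp [hb, hj.ne]⟩, fun x hLx _ hx => ?_⟩
  · rw [hlt i x (hx.trans_le hm), hagree i x hx]
  · refine hL₁ e fun i x hx => ?_
    rw [he i x (by omega), hlt i x (by omega)]
  -- Before `m` the coordinate `i₀` vanishes; after `m` the only ones of `a` and `b` sit at the
  -- different distances `J` and `K`.
  · rcases lt_trichotomy x m with h | h | h
    · have := hx i₀
      rw [hlt i₀ x h, hzero x hLx] at this
      cases this
    · exact h
    · obtain ⟨j, rfl⟩ := Nat.exists_eq_add_of_le (show m + 1 ≤ x from h)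
      have h1 := hx a
      have h2 := hx b
      rw [ha, decide_eq_true_eq] at h1
      rw [hb, decide_eq_true_eq] at h2
      exact (hJK (h1.symm.trans h2)).elim

/-- There are reals that lie in given dense open sets and that code a given sequence of pairs of
natural numbers. Each of the open sets is dense in the strong sense that it can be met by
extending a finite condition in such a way that one of the reals vanishes from there on. -/
theorem exists_coding {ι : Type*} {a b : ι} (hab : a ≠ b) (O : ℕ → Set (ι → ℕ → Bool))
    (hopen : ∀ t, ∀ d ∈ O t, ∃ L : ℕ, ∀ d' : ι → ℕ → Bool,
      (∀ i, ∀ x < L, d' i x = d i x) → d' ∈ O t)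
    (hdense : ∀ t, ∃ i₀, ∀ (L : ℕ) (d : ι → ℕ → Bool), ∃ d' ∈ O t,
      (∀ i, ∀ x < L, d' i x = d i x) ∧ ∀ x ≥ L, d' i₀ x = false)
    (J K : ℕ → ℕ) (hJK : ∀ t, J t ≠ K t) :
    ∃ c : ι → ℕ → Bool, (∀ t, c ∈ O t) ∧ ∀ j k,
      (∃ m, (∀ i, c i m = true) ∧ NextOne (c a) m j ∧ NextOne (c b) m k) ↔
        ∃ t, J t = j ∧ K t = k := by
  have step := fun t => exists_coding_step hab (hopen t) (hdense t) (hJK t)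
  choose m L' d' hm hJ hK hagree hO hone hNJ hNK huniq using step
  -- `S t` holds the length decided before stage `t` and tuples of reals with the decided values
  -- below it.
  let S : ℕ → ℕ × (ι → ℕ → Bool) := fun t =>
    Nat.rec (0, fun _ _ => false) (fun t s => (L' t s.1 s.2, d' t s.1 s.2)) t
  have hS : ∀ t, S (t + 1) = (L' t (S t).1 (S t).2, d' t (S t).1 (S t).2) := fun t => rfl
  have hmono : StrictMono fun t => (S t).1 := strictMono_nat_of_lt_succ fun t => by
    have h1 := hm t (S t).1 (S t).2
    have h2 := hJ t (S t).1 (S t).2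
    simp only [hS]
    omega
  have hext : ∀ s t, s ≤ t → ∀ i, ∀ x < (S s).1, (S t).2 i x = (S s).2 i x := by
    intro s t hst
    induction t, hst using Nat.le_induction with
    | base => exact fun _ _ _ => rfl
    | succ t hst ih =>
      intro i x hx
      rw [← ih i x hx, hS]
      exact hagree t _ _ i x (hx.trans_le (hmono.monotone hst))
  -- The decided lengths increase strictly, so position `x` is decided by stage `x + 1`.
  let c : ι → ℕ → Bool := fun i x => (S (x + 1)).2 i x
  have hc : ∀ t i, ∀ x < (S t).1, c i x = (S t).2 i x := by
    intro t i x hx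
    rcases le_total (x + 1) t with h | h
    · exact (hext _ _ h i x ((Nat.lt_succ_self x).trans_le (hmono.le_apply (x := x + 1)))).symm
    · exact hext _ _ h i x hx
  have hc' : ∀ t i, ∀ x < L' t (S t).1 (S t).2, c i x = d' t (S t).1 (S t).2 i x :=
    fun t => hc (t + 1)
  have hmark : ∀ t, (∀ i, c i (m t (S t).1 (S t).2) = true) ∧
      NextOne (c a) (m t (S t).1 (S t).2) (J t) ∧ NextOne (c b) (m t (S t).1 (S t).2) (K t) := by
    intro t
    have h2 := hJ t (S t).1 (S t).2
    refine ⟨fun i => ?_, (hNJ t _ _).congr h2 (hc' t a),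
      (hNK t _ _).congr (hK t _ _) (hc' t b)⟩
    rw [hc' t i _ (by omega)]
    exact hone t _ _ i
  refine ⟨c, fun t => hO t _ _ c (hc' t), fun j k => ⟨?_, ?_⟩⟩
  · rintro ⟨x, hx, hxj, hxk⟩
    -- A mark lies in the block decided at some stage `t`, and that block has only the intended one.
    obtain ⟨t, ht, ht'⟩ : ∃ t, (S t).1 ≤ x ∧ x < (S (t + 1)).1 := by
      have : ∀ T, x < (S T).1 → ∃ t, (S t).1 ≤ x ∧ x < (S (t + 1)).1 := by
        intro T
        induction T with
        | zero => exact fun h => (Nat.not_lt_zero _ h).elim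
        | succ T ih =>
          intro h
          rcases lt_or_ge x (S T).1 with h' | h'
          exacts [ih h', ⟨T, h', h⟩]
      exact this (x + 1) ((Nat.lt_succ_self x).trans_le (hmono.le_apply (x := x + 1)))
    have := huniq t _ _ x ht ht' fun i => by rw [← hc' t i x ht', hx]
    subst this
    obtain ⟨-, h1, h2⟩ := hmark t
    exact ⟨t, h1.unique hxj, h2.unique hxk⟩
  · rintro ⟨t, rfl, rfl⟩
    exact ⟨_, hmark t⟩

/-! ### Finite binary sequences in a transitive model -/

theorem mem_seqCode {l : List Bool} {z : ZFSet.{u}} :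
    z ∈ seqCode l ↔ ∃ i b, l[i]? = some b ∧ z = ZFSet.pair (natCode i) (natCode b.toNat) := by
  rw [seqCode, ZFSet.mem_range]
  constructor
  · rintro ⟨i, rfl⟩
    exact ⟨i, l.get i, by simp, rfl⟩
  · rintro ⟨i, b, h, rfl⟩
    obtain ⟨hi, rfl⟩ := List.getElem?_eq_some_iff.1 h
    exact ⟨⟨i, hi⟩, rfl⟩

theorem pair_mem_seqCode {l : List Bool} {i e : ℕ} :
    ZFSet.pair (natCode.{u} i) (natCode e) ∈ seqCode l ↔ ∃ b, l[i]? = some b ∧ e = b.toNat := by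
  rw [mem_seqCode]
  constructor
  · rintro ⟨i', b, h, h'⟩
    obtain ⟨h1, h2⟩ := ZFSet.pair_inj.1 h'
    obtain rfl := natCode_injective h1
    exact ⟨b, h, natCode_injective h2⟩
  · rintro ⟨b, h, rfl⟩
    exact ⟨i, b, h, rfl⟩

theorem pair_one_mem_seqCode {l : List Bool} {i : ℕ} :
    ZFSet.pair (natCode.{u} i) (natCode 1) ∈ seqCode l ↔ l[i]? = some true := by
  rw [pair_mem_seqCode]
  constructor
  · rintro ⟨_ | _, h, h'⟩
    · simp at h'
    · exact h
  · exact fun h => ⟨true, h, rfl⟩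

theorem seqCode_injective : Function.Injective seqCode.{u} := by
  intro l l' h
  refine List.ext_getElem? fun i => ?_
  have : ∀ b, l[i]? = some b ↔ l'[i]? = some b := by
    intro b
    have key : ∀ k : List Bool,
        ZFSet.pair (natCode.{u} i) (natCode b.toNat) ∈ seqCode k ↔ k[i]? = some b := by
      intro k
      rw [pair_mem_seqCode]
      constructor
      · rintro ⟨b', hb', h⟩
        rw [hb']
        cases b <;> cases b' <;> simp_all
      · exact fun h => ⟨b, h, rfl⟩
    rw [← key, ← key, h]
  exact Option.ext fun b => this b

theorem seqCode_mem_cohenForcing (l : List Bool) : seqCode.{u} l ∈ cohenForcing :=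
  ZFSet.mem_range.2 ⟨l, rfl⟩

theorem seqCode_nil : seqCode.{u} [] = ∅ := by
  refine (ZFSet.eq_empty _).2 fun z hz => ?_
  obtain ⟨i, b, h, -⟩ := mem_seqCode.1 hz
  simp at h

theorem IsTransitiveModel.range_mem (hU : IsTransitiveModel U) {k : ℕ} (f : Fin k → ZFSet.{u})
    (hf : ∀ i, f i ∈ U) : ZFSet.range f ∈ U := by
  induction k with
  | zero =>
    have : ZFSet.range f = ∅ := (ZFSet.eq_empty _).2 fun z hz => by
      obtain ⟨i, -⟩ := ZFSet.mem_range.1 hz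
      exact i.elim0
    exact this ▸ hU.empty_mem
  | succ k ih =>
    have : ZFSet.range f = insert (f 0) (ZFSet.range fun i : Fin k => f i.succ) := by
      ext z
      rw [ZFSet.mem_insert_iff, ZFSet.mem_range, ZFSet.mem_range]
      refine ⟨?_, ?_⟩
      · rintro ⟨i, rfl⟩
        refine Fin.cases ?_ (fun i => ?_) i
        exacts [Or.inl rfl, Or.inr ⟨i, rfl⟩]
      · rintro (rfl | ⟨i, rfl⟩)
        exacts [⟨0, rfl⟩, ⟨_, rfl⟩]
    exact this ▸ hU.insert_mem (hf 0) (ih _ fun i => hf _)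

theorem IsTransitiveModel.seqCode_mem (hU : IsTransitiveModel U) (l : List Bool) :
    seqCode l ∈ U :=
  hU.range_mem _ fun _ => hU.pair_mem (hU.natCode_mem _) (hU.natCode_mem _)

/-- All quantifiers are bounded by sets of the model, so the description as functions from a natural
number to `2` is absolute and can be used for separation. -/
theorem mem_cohenForcing_iff {p : ZFSet.{u}} : p ∈ cohenForcing ↔ ∃ k ∈ natSet,
    (∀ z ∈ p, ∃ m ∈ k, ∃ e ∈ natCode 2, z = ZFSet.pair m e) ∧
      ∀ m ∈ k, (ZFSet.pair m (natCode 0) ∈ p ↔ ¬ ZFSet.pair m (natCode 1) ∈ p) := by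
  rw [cohenForcing, ZFSet.mem_range]
  constructor
  · rintro ⟨l, rfl⟩
    refine ⟨natCode l.length, natCode_mem_natSet _, fun z hz => ?_, fun m hm => ?_⟩
    · obtain ⟨i, b, h, rfl⟩ := mem_seqCode.1 hz
      obtain ⟨hi, -⟩ := List.getElem?_eq_some_iff.1 h
      exact ⟨_, natCode_mem_natCode.2 hi, _,
        natCode_mem_natCode.2 (Nat.lt_succ_of_le b.toNat_le), rfl⟩
    · obtain ⟨i, hi, rfl⟩ := mem_natCode.1 hm
      rw [pair_mem_seqCode, pair_mem_seqCode]
      cases hb : l[i] <;> simp [List.getElem?_eq_getElem hi, hb]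
  · rintro ⟨k, hk, h1, h2⟩
    classical
    obtain ⟨k, rfl⟩ := mem_natSet.1 hk
    let l : List Bool :=
      List.ofFn fun i : Fin k => decide (ZFSet.pair (natCode i) (natCode 1) ∈ p)
    have hl : ∀ i < k, l[i]? = some (decide (ZFSet.pair (natCode i) (natCode 1) ∈ p)) := by
      intro i hi
      simp [l, hi]
    have hl' : ∀ i b, l[i]? = some b → i < k := by
      intro i b h
      obtain ⟨hi, -⟩ := List.getElem?_eq_some_iff.1 h
      simpa [l] using hi
    have key : ∀ i < k, ∀ e < 2, ZFSet.pair (natCode i) (natCode e) ∈ seqCode l ↔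
        ZFSet.pair (natCode i) (natCode e) ∈ p := by
      intro i hi e he
      rw [pair_mem_seqCode, hl i hi]
      have h3 := h2 _ (natCode_mem_natCode.2 hi)
      by_cases hb : ZFSet.pair (natCode i) (natCode 1) ∈ p
      · interval_cases e <;> simp [hb, h3]
      · interval_cases e <;> simp [hb, h3]
    refine ⟨l, ZFSet.ext fun z => ⟨fun hz => ?_, fun hz => ?_⟩⟩
    · obtain ⟨i, b, h, rfl⟩ := mem_seqCode.1 hz
      exact (key i (hl' i b h) _ (Nat.lt_succ_of_le b.toNat_le)).1 hz
    · obtain ⟨m, hm, e, he, rfl⟩ := h1 z hz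
      obtain ⟨i, hi, rfl⟩ := mem_natCode.1 hm
      obtain ⟨e, he2, rfl⟩ := mem_natCode.1 he
      exact (key i hi e he2).2 hz

theorem IsTransitiveModel.cohenForcing_mem (hU : IsTransitiveModel U) : cohenForcing ∈ U := by
  -- The power set taken in `U` is large enough, since finite sequences belong to `U`.
  obtain ⟨b, hbU, hb⟩ := hU.exists_powerset (hU.prod_mem hU.natSet_mem (hU.natCode_mem 2))
  have hc : ∀ m k, DTerm U fun _ : Fin m → U => natCode k := fun m k =>
    DTerm.const (hU.natCode_mem k)
  have hn : ∀ m, DTerm U fun _ : Fin m → U => natSet := fun m => DTerm.const hU.natSet_mem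
  have : b.sep (fun p => ∃ k ∈ natSet,
      (∀ z ∈ p, ∃ m ∈ k, ∃ e ∈ natCode 2, z = ZFSet.pair m e) ∧
        ∀ m ∈ k, (ZFSet.pair m (natCode 0) ∈ p ↔ ¬ ZFSet.pair m (natCode 1) ∈ p)) ∈ U := by
    refine hU.sep_mem hbU ?_
    repeat' first
      | exact DTerm.var _
      | exact hc _ _
      | exact hn _
      | refine Dfn.eq ?_ (DTerm.pair hU ?_ ?_)
      | refine Dfn.mem (DTerm.pair hU ?_ ?_) ?_
      | refine Dfn.allMem hU ?_ ?_
      | refine Dfn.exMem hU ?_ ?_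
      | refine Dfn.iff ?_ ?_
      | refine Dfn.and ?_ ?_
      | refine Dfn.not ?_
  convert this using 1
  ext p
  rw [ZFSet.mem_sep, ← mem_cohenForcing_iff]
  refine ⟨fun hp => ⟨?_, hp⟩, And.right⟩
  obtain ⟨l, rfl⟩ := ZFSet.mem_range.1 hp
  refine (hb _ (hU.seqCode_mem l)).2 fun z hz => ?_
  obtain ⟨i, b, -, rfl⟩ := mem_seqCode.1 hz
  exact ZFSet.pair_mem_prod.2 ⟨natCode_mem_natSet i,
    natCode_mem_natCode.2 (Nat.lt_succ_of_le b.toNat_le)⟩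

/-! ### A name for the generic real -/

theorem initialSegment_getElem? (c : ℕ → Bool) (m i : ℕ) :
    (initialSegment c m)[i]? = if i < m then some (c i) else none := by
  by_cases h : i < m <;> simp [initialSegment, h]

theorem mem_cohenFilter {c : ℕ → Bool} {p : ZFSet.{u}} :
    p ∈ cohenFilter c ↔ ∃ m, seqCode (initialSegment c m) = p :=
  ZFSet.mem_range

/-- The real `c` as a set of natural numbers. -/
noncomputable def realSet (c : ℕ → Bool) : ZFSet.{u} :=
  ZFSet.range fun k : {k : ℕ // c k = true} => natCode k.1

theorem natCode_mem_realSet {c : ℕ → Bool} {k : ℕ} : natCode.{u} k ∈ realSet c ↔ c k = true := by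
  rw [realSet, ZFSet.mem_range]
  constructor
  · rintro ⟨⟨j, hj⟩, h⟩
    exact natCode_injective h ▸ hj
  · exact fun h => ⟨⟨k, h⟩, rfl⟩

theorem natSet_induction (P : ZFSet.{u} → Prop)
    (h : ∀ a ∈ natSet, (∀ x ∈ natSet, x ∈ a → P x) → P a) : ∀ a ∈ natSet, P a := by
  intro a
  induction a using ZFSet.inductionOn with
  | _ a ih => exact fun ha => h a ha fun x hx hxa => ih x hxa hx

theorem mem_trans_natSet : ∀ x ∈ natSet.{u}, ∀ y ∈ natSet.{u}, ∀ z ∈ natSet.{u},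
    x ∈ y → y ∈ z → x ∈ z := by
  intro x hx y hy z hz
  obtain ⟨i, rfl⟩ := mem_natSet.1 hx
  obtain ⟨j, rfl⟩ := mem_natSet.1 hy
  obtain ⟨k, rfl⟩ := mem_natSet.1 hz
  simpa only [natCode_mem_natCode] using lt_trans

/-- The name is the set of pairs of the canonical name of `k` and a condition `q` with `q k = 1`. No
genericity is involved. -/
theorem realSet_mem_cohenExtension {W : Set ZFSet.{u}} (hW : IsTransitiveModel W)
    (c : ℕ → Bool) : realSet c ∈ cohenExtension W c := by
  -- `f ∅ k` is the canonical name of `k`, the set of pairs `(f ∅ j, ∅)` for `j < k`. Here the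
  -- second `∅` is the empty condition, while the argument `∅` of `f` is a dummy parameter.
  obtain ⟨f, hfD, hf⟩ := hW.exists_recursion hW.natSet_mem (R := fun x y => x ∈ y)
    (Dfn.mem_var 0 1) mem_trans_natSet natSet_induction
    (B := fun _ _ => ∅) (DTerm.const hW.empty_mem) (T := fun x => ZFSet.pair x ∅)
    (DTerm.pair hW (DTerm.var 0) (DTerm.const hW.empty_mem))
  have hnm : ∀ k z, z ∈ f ∅ (natCode k) ↔ ∃ j < k, z = ZFSet.pair (f ∅ (natCode j)) ∅ := by
    intro k z
    rw [hf ∅ hW.empty_mem _ (natCode_mem_natSet k)]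
    constructor
    · rintro (h | ⟨x, -, hx, rfl⟩)
      · exact (ZFSet.notMem_empty _ h).elim
      · obtain ⟨j, hj, rfl⟩ := mem_natCode.1 hx
        exact ⟨j, hj, rfl⟩
    · rintro ⟨j, hj, rfl⟩
      exact Or.inr ⟨_, natCode_mem_natSet j, natCode_mem_natCode.2 hj, rfl⟩
  have hnil : (∅ : ZFSet.{u}) ∈ cohenForcing := seqCode_nil.{u} ▸ seqCode_mem_cohenForcing []
  have hname : ∀ k, IsName cohenForcing (f ∅ (natCode k)) := by
    intro k
    induction k using Nat.strong_induction_on with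
    | _ k ih =>
      refine IsName.mk _ (fun z hz => ?_) fun σ p h => ?_
      · obtain ⟨j, -, rfl⟩ := (hnm k z).1 hz
        exact ⟨_, _, hnil, rfl⟩
      · obtain ⟨j, hj, h'⟩ := (hnm k _).1 h
        exact (ZFSet.pair_inj.1 h').1 ▸ ih j hj
  have hval : ∀ k, val (cohenFilter c) (f ∅ (natCode k)) = natCode k := by
    have hG : (∅ : ZFSet.{u}) ∈ cohenFilter c := mem_cohenFilter.2 ⟨0, seqCode_nil⟩
    intro k
    induction k using Nat.strong_induction_on with
    | _ k ih =>
      ext x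
      rw [mem_val, mem_natCode]
      constructor
      · rintro ⟨σ, p, -, h, rfl⟩
        obtain ⟨j, hj, h'⟩ := (hnm k _).1 h
        rw [(ZFSet.pair_inj.1 h').1]
        exact ⟨j, hj, (ih j hj).symm⟩
      · rintro ⟨j, hj, rfl⟩
        exact ⟨_, ∅, hG, (hnm k _).2 ⟨j, hj, rfl⟩, ih j hj⟩
  have hdef : Dfn W fun v : Fin 2 → W => ∃ k ∈ natSet, ∃ q ∈ cohenForcing,
      (v 0 : ZFSet.{u}) = ZFSet.pair k q ∧ ZFSet.pair k (natCode 1) ∈ q ∧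
        (v 1 : ZFSet.{u}) = ZFSet.pair (f ∅ k) q :=
    Dfn.exMem hW (DTerm.const hW.natSet_mem) (Dfn.exMem hW (DTerm.const hW.cohenForcing_mem)
      (Dfn.and (Dfn.eq (DTerm.var _) (DTerm.pair hW (DTerm.var _) (DTerm.var _)))
        (Dfn.and (Dfn.mem (DTerm.pair hW (DTerm.var _) (DTerm.const (hW.natCode_mem 1)))
          (DTerm.var _)) (Dfn.eq (DTerm.var _) (DTerm.pair hW
            (DTerm.comp₂ hfD (DTerm.const hW.empty_mem) (DTerm.var _)) (DTerm.var _))))))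
  obtain ⟨τ, hτW, hτ⟩ := hW.exists_replacement (hW.prod_mem hW.natSet_mem hW.cohenForcing_mem)
    (Q := fun t w => ∃ k ∈ natSet, ∃ q ∈ cohenForcing,
      t = ZFSet.pair k q ∧ ZFSet.pair k (natCode 1) ∈ q ∧ w = ZFSet.pair (f ∅ k) q) hdef (by
      rintro t - w - w' - ⟨k, -, q, -, rfl, -, rfl⟩ ⟨k', -, q', -, h, -, rfl⟩
      obtain ⟨rfl, rfl⟩ := ZFSet.pair_inj.1 h
      rfl)
  have hτ' : ∀ w, w ∈ τ ↔ ∃ k l, l[k]? = some true ∧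
      w = ZFSet.pair (f ∅ (natCode k)) (seqCode l) := by
    intro w
    rw [hτ]
    constructor
    · rintro ⟨-, t, -, k, hk, q, hq, -, h, rfl⟩
      obtain ⟨k, rfl⟩ := mem_natSet.1 hk
      obtain ⟨l, rfl⟩ := ZFSet.mem_range.1 hq
      exact ⟨k, l, pair_one_mem_seqCode.1 h, rfl⟩
    · rintro ⟨k, l, h, rfl⟩
      refine ⟨hW.pair_mem (hfD.1 ![⟨_, hW.empty_mem⟩, ⟨_, hW.natCode_mem k⟩])
        (hW.seqCode_mem l), _, ZFSet.pair_mem_prod.2 ⟨natCode_mem_natSet k,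
          seqCode_mem_cohenForcing l⟩, _, natCode_mem_natSet k, _, seqCode_mem_cohenForcing l,
          rfl, pair_one_mem_seqCode.2 h, rfl⟩
  refine ⟨τ, hτW, IsName.mk _ (fun z hz => ?_) fun σ p h => ?_, ?_⟩
  · obtain ⟨k, l, -, rfl⟩ := (hτ' z).1 hz
    exact ⟨_, _, seqCode_mem_cohenForcing l, rfl⟩
  · obtain ⟨k, l, -, h'⟩ := (hτ' _).1 h
    exact (ZFSet.pair_inj.1 h').1 ▸ hname k
  · ext x
    rw [mem_val, realSet, ZFSet.mem_range]
    constructor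
    · rintro ⟨σ, p, hp, h, rfl⟩
      obtain ⟨k, l, hl, h'⟩ := (hτ' _).1 h
      obtain ⟨rfl, rfl⟩ := ZFSet.pair_inj.1 h'
      obtain ⟨m, hm⟩ := mem_cohenFilter.1 hp
      obtain rfl := seqCode_injective hm
      rw [initialSegment_getElem?] at hl
      split_ifs at hl
      exact ⟨⟨k, Option.some.inj hl⟩, (hval k).symm⟩
    · rintro ⟨⟨k, hk⟩, rfl⟩
      -- Length `k + 1` is the least at which an initial segment decides the value at `k`.
      refine ⟨_, _, mem_cohenFilter.2 ⟨k + 1, rfl⟩, (hτ' _).2 ⟨k, _, ?_, rfl⟩, hval k⟩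
      rw [initialSegment_getElem?, if_pos k.lt_succ_self, hk]

/-! ### Decoding and collapsing in a transitive model -/

theorem IsTransitiveModel.dfn_coded (hU : IsTransitiveModel U) {ι : Type*} [Finite ι]
    {c : ι → ℕ → Bool} (hc : ∀ i, realSet (c i) ∈ U) (a b : ι) :
    Dfn U fun v : Fin 2 → U => ∃ j k, (v 0 : ZFSet.{u}) = natCode j ∧
      (v 1 : ZFSet.{u}) = natCode k ∧
        ∃ m, (∀ i, c i m = true) ∧ NextOne (c a) m j ∧ NextOne (c b) m k := by
  -- The only arithmetic needed for decoding: `f m j = (m + 1) ∪ {f m i | i < j}`, which is `m + 1 +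
  -- j`.
  obtain ⟨f, hfD, hf⟩ := hU.exists_recursion hU.natSet_mem (R := fun x y => x ∈ y)
    (Dfn.mem_var 0 1) mem_trans_natSet natSet_induction
    (B := fun p _ => insert p p) (DTerm.insert hU (DTerm.var 0) (DTerm.var 0)) (T := fun x => x)
    (DTerm.var 0)
  have hadd : ∀ m j, f (natCode m) (natCode j) = natCode (m + 1 + j) := by
    intro m j
    induction j using Nat.strong_induction_on with
    | _ j ih =>
      ext z
      rw [hf _ (hU.natCode_mem m) _ (natCode_mem_natSet j), ← natCode_succ, mem_natCode,
        mem_natCode]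
      constructor
      · rintro (⟨i, hi, rfl⟩ | ⟨x, -, hx, rfl⟩)
        · exact ⟨i, by omega, rfl⟩
        · obtain ⟨i, hi, rfl⟩ := mem_natCode.1 hx
          exact ⟨m + 1 + i, by omega, (ih i hi).symm⟩
      · rintro ⟨i, hi, rfl⟩
        rcases lt_or_ge i (m + 1) with h | h
        · exact Or.inl ⟨i, h, rfl⟩
        · obtain ⟨i, rfl⟩ := Nat.exists_eq_add_of_le h
          exact Or.inr ⟨natCode i, natCode_mem_natSet i, natCode_mem_natCode.2 (by omega),
            (ih i (by omega)).symm⟩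
  have hnext : ∀ i m j, NextOne (c i) m j ↔ f (natCode m) (natCode j) ∈ realSet (c i) ∧
      ∀ x ∈ natCode j, ¬ f (natCode m) x ∈ realSet (c i) := by
    intro i m j
    rw [hadd, natCode_mem_realSet]
    refine and_congr Iff.rfl ⟨fun h x hx => ?_, fun h j' hj' => ?_⟩
    · obtain ⟨j', hj', rfl⟩ := mem_natCode.1 hx
      simp [hadd, natCode_mem_realSet, h j' hj']
    · simpa [hadd, natCode_mem_realSet] using h _ (natCode_mem_natCode.2 hj')
  have hn : ∀ m, DTerm U fun _ : Fin m → U => natSet := fun m => DTerm.const hU.natSet_mem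
  have hc' : ∀ m i, DTerm U fun _ : Fin m → U => realSet (c i) := fun m i => DTerm.const (hc i)
  have key : Dfn U fun v : Fin 2 → U => (v 0 : ZFSet.{u}) ∈ natSet ∧ (v 1 : ZFSet.{u}) ∈ natSet ∧
      ∃ m ∈ natSet, (∀ i, m ∈ realSet (c i)) ∧
        (f m (v 0) ∈ realSet (c a) ∧ ∀ x ∈ (v 0 : ZFSet.{u}), ¬ f m x ∈ realSet (c a)) ∧
        (f m (v 1) ∈ realSet (c b) ∧ ∀ x ∈ (v 1 : ZFSet.{u}), ¬ f m x ∈ realSet (c b)) := by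
    repeat' first
      | exact DTerm.var _
      | exact hc' _ _
      | exact hn _
      | refine Dfn.mem (DTerm.comp₂ hfD ?_ ?_) ?_
      | refine Dfn.exMem hU ?_ ?_
      | refine Dfn.allMem hU ?_ ?_
      | refine Dfn.and ?_ ?_
      | refine Dfn.not ?_
      | refine Dfn.forall_finite fun _ => ?_
      | refine Dfn.mem ?_ ?_
  refine key.congr fun v => ?_
  constructor
  · rintro ⟨j, k, h0, h1, m, hm, hj, hk⟩
    rw [h0, h1]
    exact ⟨natCode_mem_natSet j, natCode_mem_natSet k, natCode m, natCode_mem_natSet m,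
      fun i => natCode_mem_realSet.2 (hm i), (hnext a m j).1 hj, (hnext b m k).1 hk⟩
  · rintro ⟨h0, h1, m, hm, hmi, hj, hk⟩
    obtain ⟨j, h0⟩ := mem_natSet.1 h0
    obtain ⟨k, h1⟩ := mem_natSet.1 h1
    obtain ⟨m, rfl⟩ := mem_natSet.1 hm
    rw [← h0] at hj
    rw [← h1] at hk
    exact ⟨j, k, h0.symm, h1.symm, m, fun i => natCode_mem_realSet.1 (hmi i),
      (hnext a m j).2 hj, (hnext b m k).2 hk⟩

/-- A transitive model that can define a relation on the natural numbers isomorphic to the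
membership relation on a set of ordinals `{o k | k}` contains this set. -/
theorem IsTransitiveModel.range_mem_of_dfn (hU : IsTransitiveModel U) {o : ℕ → ZFSet.{u}}
    (ho : ∀ k, (o k).IsOrdinal) (hsurj : ∀ k, ∀ z ∈ o k, ∃ j, o j = z)
    (hR : Dfn U fun v : Fin 2 → U => ∃ j k, (v 0 : ZFSet.{u}) = natCode j ∧
      (v 1 : ZFSet.{u}) = natCode k ∧ o j ∈ o k) : ZFSet.range o ∈ U := by
  let R : ZFSet.{u} → ZFSet.{u} → Prop := fun x y =>
    ∃ j k, x = natCode j ∧ y = natCode k ∧ o j ∈ o k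
  have hRnat : ∀ j k, R (natCode j) (natCode k) ↔ o j ∈ o k := by
    intro j k
    constructor
    · rintro ⟨j', k', h, h', hjk⟩
      rwa [natCode_injective h, natCode_injective h']
    · exact fun h => ⟨j, k, rfl, rfl, h⟩
  have htrans : ∀ x ∈ natSet, ∀ y ∈ natSet, ∀ z ∈ natSet, R x y → R y z → R x z := by
    intro x hx y hy z hz
    obtain ⟨i, rfl⟩ := mem_natSet.1 hx
    obtain ⟨j, rfl⟩ := mem_natSet.1 hy
    obtain ⟨k, rfl⟩ := mem_natSet.1 hz
    rw [hRnat, hRnat, hRnat]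
    exact fun h h' => (ho k).mem_trans h h'
  -- Induction along `R` is inherited from `∈`-induction on the ordinals `o k`.
  have hind : ∀ P : ZFSet.{u} → Prop,
      (∀ a ∈ natSet, (∀ x ∈ natSet, R x a → P x) → P a) → ∀ a ∈ natSet, P a := by
    intro P h
    have : ∀ (y : ZFSet.{u}) (k : ℕ), o k = y → P (natCode k) := by
      intro y
      induction y using ZFSet.inductionOn with
      | _ y ih =>
        rintro k rfl
        refine h _ (natCode_mem_natSet k) fun x hx hxk => ?_
        obtain ⟨j, rfl⟩ := mem_natSet.1 hx
        exact ih (o j) ((hRnat j k).1 hxk) j rfl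
    intro a ha
    obtain ⟨k, rfl⟩ := mem_natSet.1 ha
    exact this _ k rfl
  -- The Mostowski collapse `f a = {f x | R x a}`; it must send `k` to `o k`.
  obtain ⟨f, hfD, hf⟩ := hU.exists_recursion hU.natSet_mem hR htrans hind
    (B := fun _ _ => ∅) (DTerm.const hU.empty_mem) (T := fun x => x) (DTerm.var 0)
  have hfo : ∀ a ∈ natSet, ∀ k, a = natCode k → f ∅ a = o k := by
    refine hind _ ?_
    rintro a ha ih k rfl
    ext z
    rw [hf ∅ hU.empty_mem _ ha]
    constructor
    · rintro (h | ⟨x, hx, hxk, rfl⟩)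
      · exact (ZFSet.notMem_empty _ h).elim
      · obtain ⟨j, rfl⟩ := mem_natSet.1 hx
        rw [ih _ hx hxk j rfl]
        exact (hRnat j k).1 hxk
    · intro hz
      obtain ⟨j, rfl⟩ := hsurj k z hz
      have hjk := (hRnat j k).2 hz
      exact Or.inr ⟨_, natCode_mem_natSet j, hjk, (ih _ (natCode_mem_natSet j) hjk j rfl).symm⟩
  have h := hU.imageOf_mem hU.natSet_mem (F := f ∅)
    (DTerm.comp₂ hfD (DTerm.const hU.empty_mem) (DTerm.var 0))
  convert h using 1
  ext z
  rw [ZFSet.mem_range, mem_imageOf]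
  constructor
  · rintro ⟨k, rfl⟩
    exact ⟨_, natCode_mem_natSet k, hfo _ (natCode_mem_natSet k) k rfl⟩
  · rintro ⟨x, hx, rfl⟩
    obtain ⟨k, rfl⟩ := mem_natSet.1 hx
    exact ⟨k, (hfo _ hx k rfl).symm⟩

/-! ### Genericity -/

theorem initialSegment_congr {c c' : ℕ → Bool} {m : ℕ} (h : ∀ x < m, c x = c' x) :
    initialSegment c m = initialSegment c' m :=
  congrArg List.ofFn (funext fun i => h i i.2)

theorem initialSegment_prefix (c : ℕ → Bool) {m m' : ℕ} (h : m ≤ m') :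
    initialSegment c m <+: initialSegment c m' := by
  rw [List.prefix_iff_getElem?]
  intro i hi
  have hi' : i < m := by simpa [initialSegment] using hi
  rw [initialSegment_getElem?, if_pos (hi'.trans_le h)]
  simp [initialSegment]

theorem eq_initialSegment_of_prefix {c : ℕ → Bool} {m : ℕ} {l : List Bool}
    (h : l <+: initialSegment c m) : l = initialSegment c l.length := by
  refine List.ext_getElem? fun i => ?_
  rw [initialSegment_getElem?]
  split_ifs with hi
  · have h1 := List.prefix_iff_getElem?.1 h i hi
    rw [initialSegment_getElem?] at h1
    split_ifs at h1
    rw [List.getElem?_eq_getElem hi, ← h1]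
  · simpa using hi

/-- A finite sequence, continued by zeros. -/
def extendZero (l : List Bool) (x : ℕ) : Bool := l[x]?.getD false

theorem initialSegment_extendZero (l : List Bool) :
    initialSegment (extendZero l) l.length = l := by
  refine List.ext_getElem? fun i => ?_
  rw [initialSegment_getElem?]
  split_ifs with hi
  · simp [extendZero, hi]
  · simpa using hi

theorem extendZero_of_prefix {c : ℕ → Bool} {L : ℕ} {l : List Bool}
    (h : initialSegment c L <+: l) {x : ℕ} (hx : x < L) : extendZero l x = c x := by
  have h1 := List.prefix_iff_getElem?.1 h x (by simpa [initialSegment] using hx)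
  rw [extendZero, h1]
  simp [initialSegment]

theorem pair_mem_cohenOrder {l l' : List Bool} :
    ZFSet.pair (seqCode.{u} l) (seqCode l') ∈ cohenOrder ↔ l' <+: l := by
  rw [cohenOrder, ZFSet.mem_range]
  constructor
  · rintro ⟨⟨⟨a, a'⟩, h⟩, h'⟩
    obtain ⟨h1, h2⟩ := ZFSet.pair_inj.1 h'
    rwa [← seqCode_injective h1, ← seqCode_injective h2]
  · exact fun h => ⟨⟨(l, l'), h⟩, rfl⟩

/-- The initial segments of any real form a filter, so only the dense sets matter. -/
theorem isCohenReal_of_forall {W : Set ZFSet.{u}} {c : ℕ → Bool}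
    (h : ∀ D ∈ W, IsDenseIn cohenForcing cohenOrder D → ∃ m, seqCode (initialSegment c m) ∈ D) :
    IsCohenReal W c where
  subset p hp := by
    obtain ⟨m, rfl⟩ := mem_cohenFilter.1 hp
    exact seqCode_mem_cohenForcing _
  nonempty := ⟨_, mem_cohenFilter.2 ⟨0, rfl⟩⟩
  upward p hp q hq hpq := by
    obtain ⟨m, rfl⟩ := mem_cohenFilter.1 hp
    obtain ⟨l, rfl⟩ := ZFSet.mem_range.1 hq
    rw [eq_initialSegment_of_prefix (pair_mem_cohenOrder.1 hpq)]
    exact mem_cohenFilter.2 ⟨_, rfl⟩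
  directed p hp q hq := by
    obtain ⟨m, rfl⟩ := mem_cohenFilter.1 hp
    obtain ⟨m', rfl⟩ := mem_cohenFilter.1 hq
    exact ⟨_, mem_cohenFilter.2 ⟨max m m', rfl⟩,
      pair_mem_cohenOrder.2 (initialSegment_prefix c (le_max_left _ _)),
      pair_mem_cohenOrder.2 (initialSegment_prefix c (le_max_right _ _))⟩
  generic D hD hd := by
    obtain ⟨m, hm⟩ := h D hD hd
    exact ⟨_, mem_cohenFilter.2 ⟨m, rfl⟩, hm⟩

/-! ### Products of Cohen forcing and sparsely dense sets -/

section Product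

variable {k : ℕ} {s : Finset (Fin k)}

theorem tupleCode_injective : Function.Injective (tupleCode.{u} (s := s)) := by
  intro t t' h
  funext i
  have h1 : ZFSet.pair (natCode.{u} (i : Fin k)) (seqCode (t i)) ∈ tupleCode t' := by
    rw [← h]
    exact ZFSet.mem_range.2 ⟨i, rfl⟩
  obtain ⟨i', h2⟩ := ZFSet.mem_range.1 h1
  obtain ⟨h3, h4⟩ := ZFSet.pair_inj.1 h2
  obtain rfl : i' = i := Subtype.ext (Fin.ext (natCode_injective h3))
  exact (seqCode_injective h4).symm

theorem pair_mem_productOrder {t t' : s → List Bool} :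
    ZFSet.pair (tupleCode.{u} t) (tupleCode t') ∈ productOrder s ↔ ∀ i, t' i <+: t i := by
  rw [productOrder, ZFSet.mem_range]
  constructor
  · rintro ⟨⟨⟨a, a'⟩, h⟩, h'⟩
    obtain ⟨h1, h2⟩ := ZFSet.pair_inj.1 h'
    rwa [← tupleCode_injective h1, ← tupleCode_injective h2]
  · exact fun h => ⟨⟨(t, t'), h⟩, rfl⟩

theorem mem_productFilter {c : Fin k → ℕ → Bool} {p : ZFSet.{u}} : p ∈ productFilter c s ↔
    ∃ m : s → ℕ, tupleCode (fun i : s => initialSegment (c i) (m i)) = p :=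
  ZFSet.mem_range

theorem mutuallyGeneric_of_forall {W : Set ZFSet.{u}} {c : Fin k → ℕ → Bool}
    (h : ∀ D ∈ W, IsDenseIn (productForcing s) (productOrder s) D →
      ∃ m : s → ℕ, tupleCode (fun i : s => initialSegment (c i) (m i)) ∈ D) :
    MutuallyGeneric W c s where
  subset p hp := by
    obtain ⟨m, rfl⟩ := mem_productFilter.1 hp
    exact ZFSet.mem_range.2 ⟨_, rfl⟩
  nonempty := ⟨_, mem_productFilter.2 ⟨fun _ => 0, rfl⟩⟩
  upward p hp q hq hpq := by
    obtain ⟨m, rfl⟩ := mem_productFilter.1 hp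
    obtain ⟨t, rfl⟩ := ZFSet.mem_range.1 hq
    refine mem_productFilter.2 ⟨fun i => (t i).length, congrArg _ (funext fun i => ?_)⟩
    exact (eq_initialSegment_of_prefix (pair_mem_productOrder.1 hpq i)).symm
  directed p hp q hq := by
    obtain ⟨m, rfl⟩ := mem_productFilter.1 hp
    obtain ⟨m', rfl⟩ := mem_productFilter.1 hq
    exact ⟨_, mem_productFilter.2 ⟨fun i => max (m i) (m' i), rfl⟩,
      pair_mem_productOrder.2 fun i => initialSegment_prefix _ (le_max_left _ _),
      pair_mem_productOrder.2 fun i => initialSegment_prefix _ (le_max_right _ _)⟩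
  generic D hD hd := by
    obtain ⟨m, hm⟩ := h D hD hd
    exact ⟨_, mem_productFilter.2 ⟨m, rfl⟩, hm⟩

/-- A set of tuples of reals that is open, and dense in the sense that it can be met by extending
a finite condition in such a way that one of the reals vanishes from there on. -/
structure IsSparselyDense {ι : Type*} (O : Set (ι → ℕ → Bool)) : Prop where
  isOpen : ∀ d ∈ O, ∃ L : ℕ, ∀ d' : ι → ℕ → Bool, (∀ i, ∀ x < L, d' i x = d i x) → d' ∈ O
  dense : ∃ i₀, ∀ (L : ℕ) (d : ι → ℕ → Bool), ∃ d' ∈ O,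
    (∀ i, ∀ x < L, d' i x = d i x) ∧ ∀ x ≥ L, d' i₀ x = false

/-- A coordinate `i₀` outside the proper subset `s` is not constrained by `D` and can be continued
by zeros. -/
theorem isSparselyDense_tuple {D : ZFSet.{u}} (hs : s ⊂ Finset.univ)
    (hD : IsDenseIn (productForcing s) (productOrder s) D) :
    IsSparselyDense {c : Fin k → ℕ → Bool |
      ∃ m : s → ℕ, tupleCode (fun i : s => initialSegment (c i) (m i)) ∈ D} where
  isOpen := by
    rintro d ⟨m, hm⟩
    -- Membership depends only on values below the longest of the segments used.
    refine ⟨Finset.univ.sup m, fun d' hd' => ⟨m, ?_⟩⟩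
    convert hm using 3 with i
    exact initialSegment_congr fun x hx =>
      hd' i x (hx.trans_le (Finset.le_sup (f := m) (Finset.mem_univ i)))
  dense := by
    obtain ⟨i₀, -, hi₀⟩ := Finset.exists_of_ssubset hs
    refine ⟨i₀, fun L d => ?_⟩
    obtain ⟨q, hqD, hq⟩ := hD.2 (tupleCode fun i : s => initialSegment (d i) L)
      (ZFSet.mem_range.2 ⟨_, rfl⟩)
    obtain ⟨t, rfl⟩ := ZFSet.mem_range.1 (hD.1 hqD)
    have ht := pair_mem_productOrder.1 hq
    refine ⟨fun i => if h : i ∈ s then extendZero (t ⟨i, h⟩) else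
      fun x => if x < L then d i x else false, ⟨fun i => (t i).length, ?_⟩, fun i x hx => ?_,
      fun x hx => ?_⟩
    · convert hqD using 2
      funext i
      beta_reduce
      rw [dif_pos i.2]
      exact initialSegment_extendZero _
    · dsimp only
      split_ifs with h
      · exact extendZero_of_prefix (ht ⟨i, h⟩) hx
      · exact if_pos hx
    · simp [hi₀, hx.not_gt]

end Product

/-- Only coordinate `i` is constrained, so any other coordinate `j` may vanish. -/
theorem isSparselyDense_single {ι : Type*} {i j : ι} (hij : j ≠ i) {D : ZFSet.{u}}
    (hD : IsDenseIn cohenForcing cohenOrder D) :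
    IsSparselyDense {c : ι → ℕ → Bool | ∃ m, seqCode (initialSegment (c i) m) ∈ D} where
  isOpen := by
    rintro d ⟨m, hm⟩
    refine ⟨m, fun d' hd' => ⟨m, ?_⟩⟩
    rwa [initialSegment_congr (hd' i)]
  dense := by
    classical
    refine ⟨j, fun L d => ?_⟩
    obtain ⟨q, hqD, hq⟩ := hD.2 _ (seqCode_mem_cohenForcing (initialSegment (d i) L))
    obtain ⟨l, rfl⟩ := ZFSet.mem_range.1 (hD.1 hqD)
    refine ⟨fun i' => if i' = i then extendZero l else fun x => if x < L then d i' x else false,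
      ⟨l.length, ?_⟩, fun i' x hx => ?_, fun x hx => ?_⟩
    · beta_reduce
      rwa [if_pos rfl, initialSegment_extendZero]
    · dsimp only
      split_ifs with h
      · subst h
        exact extendZero_of_prefix (pair_mem_cohenOrder.1 hq) hx
      · exact if_pos hx
    · simp [hij, hx.not_gt]

theorem isSparselyDense_ne {ι : Type*} {i j : ι} (hij : j ≠ i) :
    IsSparselyDense {c : ι → ℕ → Bool | c i ≠ c j} where
  isOpen := by
    intro d hd
    obtain ⟨x, hx⟩ := Function.ne_iff.1 (show d i ≠ d j from hd)
    refine ⟨x + 1, fun d' hd' h => hx ?_⟩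
    rw [← hd' i x x.lt_succ_self, ← hd' j x x.lt_succ_self, h]
  dense := by
    classical
    -- From `L` on, coordinate `i` is constantly one and all others are zero, so `i` and `j` differ
    -- at `L`.
    refine ⟨j, fun L d => ⟨fun i' x => if x < L then d i' x else decide (i' = i), fun h => ?_,
      fun i' x hx => if_pos hx, fun x hx => ?_⟩⟩
    · simpa [hij] using congrFun h L
    · simp [hij, hx.not_gt]

end CohenAmalgamation

/-! ### Reals that jointly code the height of `W` -/

open CohenAmalgamation in
theorem mainTheorem6 (W : Set ZFSet.{u}) (hcount : W.Countable)
    (hW : CohenAmalgamation.IsTransitiveModel W) (n : ℕ) (hn : 1 ≤ n) :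
    ∃ c : Fin (n + 1) → ℕ → Bool,
      Function.Injective c ∧
      (∀ i, CohenAmalgamation.IsCohenReal W (c i)) ∧
      (∀ s : Finset (Fin (n + 1)), s ⊂ Finset.univ →
        CohenAmalgamation.MutuallyGeneric W c s) ∧
      ¬ ∃ U : Set ZFSet.{u}, CohenAmalgamation.IsTransitiveModel U ∧
          CohenAmalgamation.SameOrdinals W U ∧
          ∀ i, CohenAmalgamation.cohenExtension W (c i) ⊆ U := by
  let a : Fin (n + 1) := ⟨0, by omega⟩
  let b : Fin (n + 1) := ⟨1, by omega⟩
  have hab : a ≠ b := fun h => by simpa [a, b] using congrArg Fin.val h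
  have : Nontrivial (Fin (n + 1)) := ⟨a, b, hab⟩
  -- An enumeration of the ordinals of `W`, and of the membership relation between them.
  obtain ⟨o, ho⟩ := (hcount.mono (fun x hx => hx.1 : {x | x ∈ W ∧ x.IsOrdinal} ⊆ W)).exists_eq_range
    ⟨∅, hW.empty_mem, ZFSet.isOrdinal_empty⟩
  have ho' : ∀ x, (x ∈ W ∧ x.IsOrdinal) ↔ ∃ k, o k = x := fun x => Set.ext_iff.1 ho x
  have hoW : ∀ k, o k ∈ W ∧ (o k).IsOrdinal := fun k => (ho' _).2 ⟨k, rfl⟩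
  -- Enumeration by `ℕ` requires a nonempty set; `∅ ∈ {∅}` supplies a pair.
  obtain ⟨q, hq⟩ := (Set.to_countable {p : ℕ × ℕ | o p.1 ∈ o p.2}).exists_eq_range (by
    obtain ⟨j, hj⟩ := (ho' _).1 ⟨hW.empty_mem, ZFSet.isOrdinal_empty⟩
    obtain ⟨k, hk⟩ := (ho' _).1 ⟨hW.insert_mem hW.empty_mem hW.empty_mem,
      ZFSet.isOrdinal_succ ZFSet.isOrdinal_empty⟩
    exact ⟨(j, k), show o j ∈ o k by rw [hj, hk]; exact ZFSet.mem_insert _ _⟩)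
  have hq' : ∀ j k, o j ∈ o k ↔ ∃ t, (q t).1 = j ∧ (q t).2 = k := fun j k => by
    refine (Set.ext_iff.1 hq (j, k)).trans ?_
    simp only [Set.mem_range, Prod.ext_iff]
  -- An enumeration of the open sets that have to be met.
  let F : Set (Set (Fin (n + 1) → ℕ → Bool)) :=
    {O | IsSparselyDense O ∧ ((∃ D ∈ W, ∃ s : Finset (Fin (n + 1)), O =
        {c | ∃ m : s → ℕ, tupleCode (fun i : s => initialSegment (c i) (m i)) ∈ D}) ∨
      (∃ D ∈ W, ∃ i, O = {c | ∃ m, seqCode (initialSegment (c i) m) ∈ D}) ∨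
      ∃ i j, O = {c | c i ≠ c j})}
  have hFc : F.Countable := by
    refine Set.Countable.mono (fun O hO => hO.2) ?_
    refine Set.Countable.union ?_ (Set.Countable.union ?_ ?_)
    · have := hcount.biUnion (t := fun D _ => Set.range fun s : Finset (Fin (n + 1)) =>
        {c : Fin (n + 1) → ℕ → Bool |
          ∃ m : s → ℕ, tupleCode (fun i : s => initialSegment (c i) (m i)) ∈ D})
        fun D _ => Set.countable_range _
      refine this.mono ?_
      rintro O ⟨D, hD, s, rfl⟩
      exact Set.mem_biUnion hD ⟨s, rfl⟩
    · have := hcount.biUnion (t := fun D _ => Set.range fun i : Fin (n + 1) =>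
        {c : Fin (n + 1) → ℕ → Bool | ∃ m, seqCode (initialSegment (c i) m) ∈ D})
        fun D _ => Set.countable_range _
      refine this.mono ?_
      rintro O ⟨D, hD, i, rfl⟩
      exact Set.mem_biUnion hD ⟨i, rfl⟩
    · refine (Set.countable_range fun p : Fin (n + 1) × Fin (n + 1) =>
        {c : Fin (n + 1) → ℕ → Bool | c p.1 ≠ c p.2}).mono ?_
      rintro O ⟨i, j, rfl⟩
      exact ⟨(i, j), rfl⟩
  obtain ⟨O, hO⟩ := hFc.exists_eq_range
    ⟨_, isSparselyDense_ne hab.symm, Or.inr (Or.inr ⟨a, b, rfl⟩)⟩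
  have hOF : ∀ t, O t ∈ F := fun t => hO ▸ Set.mem_range_self t
  obtain ⟨c, hcO, hcode⟩ := exists_coding hab O (fun t => (hOF t).1.isOpen)
    (fun t => (hOF t).1.dense) (fun t => (q t).1) (fun t => (q t).2) (fun t h => by
      -- The two recorded numbers differ because no set is an element of itself.
      have : o (q t).1 ∈ o (q t).2 := (hq' _ _).2 ⟨t, rfl, rfl⟩
      rw [h] at this
      exact ZFSet.mem_irrefl _ this)
  have hc : ∀ S ∈ F, c ∈ S := by
    intro S hS
    rw [hO] at hS
    obtain ⟨t, rfl⟩ := hS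
    exact hcO t
  refine ⟨c, fun i j hij => ?_, fun i => isCohenReal_of_forall fun D hD hd => ?_,
    fun s hs => mutuallyGeneric_of_forall fun D hD hd => ?_, ?_⟩
  · by_contra hne
    exact hc _ ⟨isSparselyDense_ne (Ne.symm hne), Or.inr (Or.inr ⟨i, j, rfl⟩)⟩ hij
  -- As `n ≥ 1`, there is a second coordinate to hold at zero.
  · obtain ⟨j, hj⟩ := exists_ne i
    exact hc _ ⟨isSparselyDense_single hj hd, Or.inr (Or.inl ⟨D, hD, i, rfl⟩)⟩
  · exact hc _ ⟨isSparselyDense_tuple hs hd, Or.inl ⟨D, hD, s, rfl⟩⟩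
  · rintro ⟨U, hU, hsame, hsub⟩
    have hreal : ∀ i, realSet (c i) ∈ U := fun i => hsub i (realSet_mem_cohenExtension hW (c i))
    -- `U` decodes the membership relation on the ordinals of `W` and collapses it to the set of all
    -- of them.
    have hmem : ZFSet.range o ∈ U := by
      refine hU.range_mem_of_dfn (fun k => (hoW k).2) (fun k z hz =>
        (ho' z).1 ⟨hW.mem_of_mem (hoW k).1 hz, (hoW k).2.mem hz⟩) ?_
      refine (hU.dfn_coded hreal a b).congr fun v => ?_
      simp only [hq', hcode]
    have hord : (ZFSet.range o).IsOrdinal := by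
      rw [ZFSet.isOrdinal_iff_forall_mem_isOrdinal]
      constructor
      · intro x hx z hz
        obtain ⟨k, rfl⟩ := ZFSet.mem_range.1 hx
        exact ZFSet.mem_range.2 ((ho' z).1 ⟨hW.mem_of_mem (hoW k).1 hz, (hoW k).2.mem hz⟩)
      · intro x hx
        obtain ⟨k, rfl⟩ := ZFSet.mem_range.1 hx
        exact (hoW k).2
    -- Burali-Forti: this set is an ordinal of `U`, hence of `W`, hence an element of itself.
    exact ZFSet.mem_irrefl _ (ZFSet.mem_range.2 ((ho' _).1 ⟨(hsame _ hord).2 hmem, hord⟩))
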